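/- Let $d\ge 0$ be an integer and $\mu\in(-1,1)$. Let $\mathbf A_\mu$ be the universal enveloping $C^*$-algebra of the unital $*$-algebra with generators $a_1,\dots,a_d$ and the relations (twisted CCR of Pusz–Woronowicz) $$a_i^*a_i=1+\mu^2a_ia_i^*-(1-\mu^2)\sum_{k<i}a_ka_k^*,\qquad a_i^*a_j=\mu\,a_ja_i^*\ (i\neq j),\qquad a_ja_i=\mu\,a_ia_j\ (i<j),$$ and let $\mathbf A_0$ be the universal enveloping $C^*$-algebra of the unital $*$-algebra with generators $t_1,\dots,t_d$ (which are then partial isometries) and the relations $$t_i^*t_j=\delta_{ij}\Bigl(1-\sum_{k<i}t_kt_k^*\Bigr),\qquad t_jt_i=0\ (j>i).$$ Here the universal enveloping $C^*$-algebra of a $*$-algebra is its separated completion in the seminorm $\|x\|=\sup_\pi\|\pi(x)\|$, the supremum being over all representations $\pi$ by bounded Hilbert space operators (it is finite in both cases). Then there is a $*$-isomorphism $\varphi\colon\mathbf A_0\to\mathbf A_\mu$ with $\varphi(t_i)=\widehat S_i$ and $\varphi^{-1}(a_i)=\widetilde a_i$ for $i=1,\dots,d$. Here: * for any realisation (unital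 $*$-representation) of $\mathbf A_\mu$ on a Hilbert space, $a_i^*=S_i^*C_i$ is the polar decomposition of the image of $a_i^*$ ($C_i\ge 0$, $S_i^*$ a partial isometry with $\ker S_i^*=\ker C_i$), and inductively $\widehat S_i=\bigl(1-\sum_{j<i}\widehat S_j\widehat S_j^*\bigr)S_i$ (so $\widehat S_1=S_1$); the equality $\varphi(t_i)=\widehat S_i$ holds in every such realisation; * in $\mathbf A_0$, $\widetilde a_i=a_i^{(1)}$, where $$a_i^{(i)}=\Bigl(\sum_{n=1}^\infty\mu^{2(n-1)}t_i^nt_i^{*n}\Bigr)^{1/2}t_i,\qquad a_i^{(j)}=\sum_{n=0}^\infty\mu^n\,t_j^n\,a_i^{(j+1)}\,t_j^{*n}\quad(1\le j<i),$$ with norm-convergent series and $0^0=1$. -/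

import Mathlib

open scoped ENNReal

noncomputable section

/-- The twisted canonical commutation relations of Pusz and Woronowicz with parameter `μ`, for a
family `a₁, …, a_d` in a unital `*`-algebra. -/
structure IsTCCR {B : Type*} [Ring B] [StarRing B] [Algebra ℂ B] {d : ℕ} (μ : ℝ)
    (a : Fin d → B) : Prop where
  star_mul_self : ∀ i, star (a i) * a i = 1 + ((μ ^ 2 : ℝ) : ℂ) • (a i * star (a i))
    - ((1 - μ ^ 2 : ℝ) : ℂ) • ∑ k ∈ Finset.Iio i, a k * star (a k)
  star_mul : ∀ i j, i ≠ j → star (a i) * a j = (μ : ℂ) • (a j * star (a i))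
  mul : ∀ i j, i < j → a j * a i = (μ : ℂ) • (a i * a j)

/-- The relations `t_i^* t_j = δ_ij (1 - ∑_{k < i} t_k t_k^*)` and `t_j t_i = 0` for `j > i`, for a
family `t₁, …, t_d` in a unital `*`-algebra. -/
structure IsTwistedIsometries {B : Type*} [Ring B] [StarRing B] {d : ℕ} (t : Fin d → B) :
    Prop where
  star_mul : ∀ i j, star (t i) * t j =
    if i = j then 1 - ∑ k ∈ Finset.Iio i, t k * star (t k) else 0
  mul : ∀ i j, i < j → t j * t i = 0

/-- A system of relations between `d` generators and their adjoints, through the families of bounded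
Hilbert space operators that satisfy it. -/
abbrev OpRelation (d : ℕ) : Type 1 :=
  ∀ (H : Type) [NormedAddCommGroup H] [InnerProductSpace ℂ H] [CompleteSpace H],
    (Fin d → (H →L[ℂ] H)) → Prop

/-- A bounded (unital) representation, on a nonzero Hilbert space, of the `*`-algebra given by the
relations `R`: a family of bounded operators that satisfies `R`. -/
structure OpRep {d : ℕ} (R : OpRelation d) : Type 1 where
  H : Type
  [normedAddCommGroup : NormedAddCommGroup H]
  [innerProductSpace : InnerProductSpace ℂ H]
  [completeSpace : CompleteSpace H]
  [nontrivial : Nontrivial H]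
  op : Fin d → (H →L[ℂ] H)
  rel : R H op

attribute [instance] OpRep.normedAddCommGroup OpRep.innerProductSpace OpRep.completeSpace
  OpRep.nontrivial

/-- The relations `R` bound the norms of the generators uniformly over all representations. -/
def OpRelation.IsBounded {d : ℕ} (R : OpRelation d) : Prop :=
  ∀ i, ∃ C : ℝ, ∀ π : OpRep R, ‖π.op i‖ ≤ C

/-- The `C^*`-algebra of all uniformly bounded families `(x_π)`, `x_π` a bounded operator on the
space of the representation `π`, with the norm `sup_π ‖x_π‖`. -/
def OpFamilies {d : ℕ} (R : OpRelation d) : Type 1 :=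
  lp (fun π : OpRep R => π.H →L[ℂ] π.H) ∞

instance {d : ℕ} (R : OpRelation d) : NormedRing (OpFamilies R) :=
  inferInstanceAs (NormedRing (lp (fun π : OpRep R => π.H →L[ℂ] π.H) ∞))

instance {d : ℕ} (R : OpRelation d) : StarRing (OpFamilies R) :=
  inferInstanceAs (StarRing (lp (fun π : OpRep R => π.H →L[ℂ] π.H) ∞))

instance {d : ℕ} (R : OpRelation d) : NormedAlgebra ℂ (OpFamilies R) :=
  inferInstanceAs (NormedAlgebra ℂ (lp (fun π : OpRep R => π.H →L[ℂ] π.H) ∞))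

instance {d : ℕ} (R : OpRelation d) : CStarAlgebra (OpFamilies R) where
  toCompleteSpace := inferInstanceAs (CompleteSpace (lp (fun π : OpRep R => π.H →L[ℂ] π.H) ∞))
  norm_mul_self_le :=
    (inferInstance : CStarRing (lp (fun π : OpRep R => π.H →L[ℂ] π.H) ∞)).norm_mul_self_le
  star_smul := (inferInstance : StarModule ℂ (lp (fun π : OpRep R => π.H →L[ℂ] π.H) ∞)).star_smul

/-- The `i`-th generator in the universal representation: the family `(π(x_i))_π`. -/
def OpRelation.universalOp {d : ℕ} (R : OpRelation d) (hR : R.IsBounded) (i : Fin d) :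
    OpFamilies R :=
  ⟨fun π => π.op i, memℓp_infty (by
    obtain ⟨C, hC⟩ := hR i
    exact ⟨C, by rintro _ ⟨π, rfl⟩; exact hC π⟩)⟩

/-- The closed unital `*`-subalgebra generated by the generators in the universal
representation. -/
def OpRelation.universalSubalgebra {d : ℕ} (R : OpRelation d) (hR : R.IsBounded) :
    StarSubalgebra ℂ (OpFamilies R) :=
  (StarAlgebra.adjoin ℂ (Set.range (R.universalOp hR))).topologicalClosure

/-- The universal enveloping `C^*`-algebra of the `*`-algebra with generators `x₁, …, x_d` and
relations `R`, that is, the (separated) completion of that `*`-algebra in the seminorm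
`‖x‖ = sup_π ‖π(x)‖` over all bounded representations. (Hilbert spaces in `Type` suffice, as the
supremum is attained on cyclic, hence separable, ones.) -/
def OpRelation.UniversalCStar {d : ℕ} (R : OpRelation d) (hR : R.IsBounded) : Type 1 :=
  R.universalSubalgebra hR

instance {d : ℕ} (R : OpRelation d) (hR : R.IsBounded) : CStarAlgebra (R.UniversalCStar hR) :=
  StarSubalgebra.cstarAlgebra (R.universalSubalgebra hR)
    (h_closed := StarSubalgebra.isClosed_topologicalClosure _)

/-- The generators of the universal enveloping `C^*`-algebra. -/
def OpRelation.gen {d : ℕ} (R : OpRelation d) (hR : R.IsBounded) (i : Fin d) :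
    R.UniversalCStar hR :=
  ⟨R.universalOp hR i, StarSubalgebra.le_topologicalClosure _
    (StarAlgebra.subset_adjoin ℂ _ ⟨i, rfl⟩)⟩

/-- The norm estimate behind the existence of the two universal `C^*`-algebras. -/
theorem norm_sq_le_of_star_mul_self {H : Type*} [NormedAddCommGroup H] [InnerProductSpace ℂ H]
    [CompleteSpace H] {ι : Type*} (s : Finset ι) (b : ι → (H →L[ℂ] H)) (a : H →L[ℂ] H)
    {c e : ℝ} (hc : 0 ≤ c) (hc1 : c < 1) (he : 0 ≤ e)
    (h : star a * a = 1 + (c : ℂ) • (a * star a) - (e : ℂ) • ∑ k ∈ s, b k * star (b k)) :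
    ‖a‖ ^ 2 ≤ 1 / (1 - c) := by
  have key : ‖a‖ ^ 2 ≤ 1 + c * ‖a‖ ^ 2 := by
    have h0 : 0 ≤ 1 + c * ‖a‖ ^ 2 := by positivity
    have : ‖a‖ ≤ √(1 + c * ‖a‖ ^ 2) := by
      refine ContinuousLinearMap.opNorm_le_bound _ (Real.sqrt_nonneg _) fun x => ?_
      have hs : ∀ (u : H →L[ℂ] H), inner ℂ ((u * star u) x) x = ((‖star u x‖ ^ 2 : ℝ) : ℂ) := by
        intro u
        have : inner ℂ ((u * star u) x) x = inner ℂ (star u x) (star u x) := by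
          rw [ContinuousLinearMap.star_eq_adjoint, ContinuousLinearMap.adjoint_inner_right]
          rfl
        rw [this, inner_self_eq_norm_sq_to_K]
        simp
      have h1 : ‖a x‖ ^ 2 = ‖x‖ ^ 2 + c * ‖star a x‖ ^ 2 - e * ∑ k ∈ s, ‖star (b k) x‖ ^ 2 := by
        have h2 := congrArg (fun u : H →L[ℂ] H => inner ℂ (u x) x) h
        have h3 := hs (star a)
        rw [star_star] at h3
        simp only [h3, sub_apply, add_apply, smul_apply, sum_apply, inner_sub_left,
          inner_add_left, inner_smul_left, sum_inner, hs, Complex.conj_ofReal] at h2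
        rw [one_apply_eq_self, inner_self_eq_norm_sq_to_K] at h2
        simp only [Complex.coe_algebraMap] at h2
        exact_mod_cast h2
      have h4 : ‖star a x‖ ≤ ‖a‖ * ‖x‖ := by
        simpa using (star a).le_opNorm x
      have h5 : ‖star a x‖ ^ 2 ≤ ‖a‖ ^ 2 * ‖x‖ ^ 2 := by
        rw [← mul_pow]; gcongr
      have h6 : 0 ≤ e * ∑ k ∈ s, ‖star (b k) x‖ ^ 2 := by positivity
      have h7 : ‖a x‖ ^ 2 ≤ (1 + c * ‖a‖ ^ 2) * ‖x‖ ^ 2 := by nlinarith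
      refine le_of_sq_le_sq ?_ (by positivity)
      rw [mul_pow, Real.sq_sqrt h0]
      exact h7
    calc ‖a‖ ^ 2 ≤ √(1 + c * ‖a‖ ^ 2) ^ 2 := by gcongr
      _ = _ := Real.sq_sqrt h0
  rw [le_div_iff₀ (by linarith)]
  linarith

/-- The twisted canonical commutation relations as a system of relations. -/
def tccr (d : ℕ) (μ : ℝ) : OpRelation d := fun _ _ _ _ a => IsTCCR μ a

theorem tccr_isBounded (d : ℕ) {μ : ℝ} (hμ : μ ∈ Set.Ioo (-1 : ℝ) 1) : (tccr d μ).IsBounded := by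
  intro i
  have h1 : μ ^ 2 < 1 := by nlinarith [hμ.1, hμ.2]
  exact ⟨√(1 / (1 - μ ^ 2)), fun π => Real.le_sqrt_of_sq_le
    (norm_sq_le_of_star_mul_self _ _ _ (sq_nonneg μ) h1 (by linarith) (π.rel.star_mul_self i))⟩

/-- The relations of the partial isometries `t_i` as a system of relations. -/
def twistedIsometries (d : ℕ) : OpRelation d := fun _ _ _ _ t => IsTwistedIsometries t

theorem twistedIsometries_isBounded (d : ℕ) : (twistedIsometries d).IsBounded := by
  intro i
  refine ⟨√(1 / (1 - 0)), fun π => Real.le_sqrt_of_sq_le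
    (norm_sq_le_of_star_mul_self (Finset.Iio i) π.op _ le_rfl zero_lt_one zero_le_one ?_)⟩
  have := π.rel.star_mul i i
  simp only [if_true] at this
  simp [this]

/-- The universal enveloping `C^*`-algebra `A_μ` of the twisted canonical commutation relations. -/
abbrev TCCRAlgebra (d : ℕ) (μ : ℝ) (hμ : μ ∈ Set.Ioo (-1 : ℝ) 1) : Type 1 :=
  (tccr d μ).UniversalCStar (tccr_isBounded d hμ)

/-- The generators `a_i` of `A_μ`. -/
abbrev TCCRAlgebra.a (d : ℕ) (μ : ℝ) (hμ : μ ∈ Set.Ioo (-1 : ℝ) 1) (i : Fin d) :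
    TCCRAlgebra d μ hμ :=
  (tccr d μ).gen (tccr_isBounded d hμ) i

/-- The universal `C^*`-algebra `A_0` generated by the partial isometries `t_i`. -/
abbrev TwistedIsometryAlgebra (d : ℕ) : Type 1 :=
  (twistedIsometries d).UniversalCStar (twistedIsometries_isBounded d)

/-- The generators `t_i` of `A_0`. -/
abbrev TwistedIsometryAlgebra.t (d : ℕ) (i : Fin d) : TwistedIsometryAlgebra d :=
  (twistedIsometries d).gen (twistedIsometries_isBounded d) i

/-- `T = U C` is the polar decomposition of the bounded operator `T`: `C` is positive, `U` is a
partial isometry, and `U` and `C` have the same kernel. -/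
structure IsPolarDecomposition {H : Type*} [NormedAddCommGroup H] [InnerProductSpace ℂ H]
    [CompleteSpace H] (T U C : H →L[ℂ] H) : Prop where
  eq_mul : T = U * C
  isPositive : C.IsPositive
  partialIsometry : U * star U * U = U
  ker_eq : ∀ x, U x = 0 ↔ C x = 0

/-- `Ŝ_i = (1 - ∑_{j < i} Ŝ_j Ŝ_j^*) S_i`, inductively. -/
def hatS {B : Type*} [Ring B] [StarRing B] {d : ℕ} (S : Fin d → B) (i : Fin d) : B :=
  (1 - ∑ j : {j : Fin d // j < i}, hatS S j.1 * star (hatS S j.1)) * S i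
termination_by i.val
decreasing_by exact j.2

/-- `b i j` (for `j ≤ i`, indices counted from `0`) is the family with
`b i i = (∑_{n ≥ 0} μ^{2n} t_i^{n+1} (t_i^*)^{n+1})^{1/2} t_i` and
`b i j = ∑_{n ≥ 0} μ^n t_j^n (b i (j+1)) (t_j^*)^n` for `j < i`, the series converging in norm. -/
structure IsTildeFamily {A : Type*} [CStarAlgebra A] {d : ℕ} (μ : ℝ) (t : Fin d → A)
    (b : Fin d → ℕ → A) : Prop where
  diag : ∀ i : Fin d, ∃ Q : A,
    HasSum (fun n : ℕ => ((μ ^ (2 * n) : ℝ) : ℂ) • (t i ^ (n + 1) * star (t i) ^ (n + 1))) Q ∧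
      b i i = cfc Real.sqrt Q * t i
  step : ∀ i j : Fin d, j < i →
    HasSum (fun n : ℕ => ((μ ^ n : ℝ) : ℂ) • (t j ^ n * b i (j + 1) * star (t j) ^ n)) (b i j)

end

/-!
With the generators indexed from `0`, the first one, `a = a₀`, satisfies `a^* a = 1 + μ² a a^*`,
which is bounded below by `1`, so `t = a (1 + μ² a a^*)^{-1/2}` is an isometry that lies in the
`C^*`-algebra generated by `a`. Moreover `Q = a a^*` solves `Q = t t^* + μ² t Q t^*`, hence
`Q = ∑ μ²ⁿ tⁿ⁺¹ (t^*)ⁿ⁺¹`, and uniqueness of positive square roots gives `a = Q^{1/2} t`. The later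
generators `a_i` satisfy `t^* a_i = μ a_i t^*` and `a_i t = μ t a_i`. Therefore they commute with
`P = 1 - t t^*`, their compressions `P a_i` satisfy the same relations in the corner of `P`, and
`a_i = P a_i + μ t a_i t^*`, that is, `a_i = ∑ μⁿ tⁿ (P a_i) (t^*)ⁿ`.

Conversely, for an isometry `t` and a solution `(x_i)` in the corner of `P = 1 - t t^*`, the elements
`Q^{1/2} t` and `y_i = ∑ μⁿ tⁿ x_i (t^*)ⁿ` satisfy the relations. Both directions rest on one remark:
for `‖t‖ ≤ 1` and `|c| < 1` the equation `y = x + c t y t^*` has exactly one solution `y`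
(`IsDilation.unique`). Since `t` is an isometry with `P t = 0`, a product of two such solutions is
again a solution, with `x` and `c` replaced by the products (`IsDilation.mul`). So each relation
between the `x_i` carries over to the `y_i`.

Iteration of the two constructions (`IsCornerTCCR.compress` and `IsCornerTCCR.dilate`) through the
decreasing projections `p_j = 1 - ∑_{k < j} t_k t_k^*` gives mutually inverse passages between the
families `t` and the families `a` in any `C^*`-algebra: the isometries are recovered from the `a_i`
by `t_j = p_j a_j (1 + μ² p_j a_j a_j^*)^{-1/2}` (`IsDilationTower.isometries_unique`), and the
elements `b_i^{(j)}` are `p_j a_i`. The two universal properties then give the isomorphism.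

In a Hilbert space realisation let `a_i^* = S_i^* C_i` be the polar decomposition. As `p_i` commutes
with `a_i`, it commutes with `C_i`, so `p_i C_i` is the square root of `p_i a_i a_i^* p_i`, and
`C_i p_i S_i = p_i a_i = C_i t_i`. Both `p_i S_i` and `t_i` have their range in that of `S_i`, hence
`p_i S_i = t_i` (`IsPolarDecomposition.proj_mul_eq`), which is the recursion for `Ŝ_i`.
-/

/-! ### Dilations along a corner isometry -/

/-- `IsDilation c t x y` says that `y = ∑ cⁿ tⁿ x (t^*)ⁿ`, in the form of the equation
`y = x + c t y t^*`, which for `‖t‖ ≤ 1` and `|c| < 1` has this sum as its only solution. -/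
def IsDilation {A : Type*} [Ring A] [StarRing A] [Algebra ℂ A] (c : ℂ) (t x y : A) : Prop :=
  y = x + c • (t * y * star t)

namespace IsDilation

section Algebra

variable {A : Type*} [Ring A] [StarRing A] [Algebra ℂ A] {c : ℂ} {t x y x' y' : A}

theorem add (h : IsDilation c t x y) (h' : IsDilation c t x' y') :
    IsDilation c t (x + x') (y + y') := by
  unfold IsDilation at *
  calc y + y' = (x + c • (t * y * star t)) + (x' + c • (t * y' * star t)) := by rw [← h, ← h']
    _ = _ := by rw [mul_add, add_mul, smul_add]; abel

theorem smul (h : IsDilation c t x y) (e : ℂ) : IsDilation c t (e • x) (e • y) := by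
  unfold IsDilation at *
  calc e • y = e • (x + c • (t * y * star t)) := by rw [← h]
    _ = _ := by rw [smul_add, smul_comm e c, mul_smul_comm, smul_mul_assoc]

theorem sub (h : IsDilation c t x y) (h' : IsDilation c t x' y') :
    IsDilation c t (x - x') (y - y') := by
  simpa [sub_eq_add_neg] using h.add (h'.smul (-1))

theorem sum {ι : Type*} (s : Finset ι) {x y : ι → A} (h : ∀ i ∈ s, IsDilation c t (x i) (y i)) :
    IsDilation c t (∑ i ∈ s, x i) (∑ i ∈ s, y i) := by
  classical
  induction s using Finset.induction_on with
  | empty => simp [IsDilation]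
  | insert i s hi ih =>
    rw [Finset.sum_insert hi, Finset.sum_insert hi]
    exact (h i (Finset.mem_insert_self i s)).add
      (ih fun k hk => h k (Finset.mem_insert_of_mem hk))

theorem adjoint [StarModule ℂ A] {m : ℝ} (h : IsDilation (m : ℂ) t x y) :
    IsDilation (m : ℂ) t (star x) (star y) := by
  unfold IsDilation at *
  calc star y = star (x + (m : ℂ) • (t * y * star t)) := by rw [← h]
    _ = _ := by simp [mul_assoc]

end Algebra

end IsDilation

/-- `t` is a partial isometry with initial projection `p` and range below `p`, that is, an isometry
of the corner of the projection `p`. -/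
structure IsCornerIsometry {A : Type*} [Ring A] [StarRing A] (p t : A) : Prop where
  star_proj : star p = p
  proj_mul_self : p * p = p
  star_mul_self : star t * t = p
  proj_mul : p * t = t

namespace IsCornerIsometry

variable {A : Type*} [CStarAlgebra A] {p t : A}

theorem mul_proj (h : IsCornerIsometry p t) : t * p = t := by
  rw [← sub_eq_zero, ← CStarRing.star_mul_self_eq_zero_iff]
  have h1 : star t * (t * p) = p := by rw [← mul_assoc, h.star_mul_self, h.proj_mul_self]
  have h2 : p * star t * t = p := by rw [mul_assoc, h.star_mul_self, h.proj_mul_self]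
  have h3 : p * star t * (t * p) = p := by rw [mul_assoc, h1, h.proj_mul_self]
  rw [star_sub, star_mul, h.star_proj, sub_mul, mul_sub, mul_sub, h1, h2, h3, h.star_mul_self]
  simp

theorem proj_mul_star (h : IsCornerIsometry p t) : p * star t = star t := by
  simpa [h.star_proj] using congrArg star h.mul_proj

theorem star_mul_proj (h : IsCornerIsometry p t) : star t * p = star t := by
  simpa [h.star_proj] using congrArg star h.proj_mul

theorem compl_mul (h : IsCornerIsometry p t) : (p - t * star t) * t = 0 := by
  rw [sub_mul, mul_assoc, h.star_mul_self, h.mul_proj, h.proj_mul, sub_self]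

theorem star_compl (h : IsCornerIsometry p t) : star (p - t * star t) = p - t * star t := by
  simp [h.star_proj]

theorem star_mul_compl (h : IsCornerIsometry p t) : star t * (p - t * star t) = 0 := by
  simpa [h.star_proj] using congrArg star h.compl_mul

theorem proj_mul_compl (h : IsCornerIsometry p t) : p * (p - t * star t) = p - t * star t := by
  rw [mul_sub, ← mul_assoc, h.proj_mul, h.proj_mul_self]

theorem compl_mul_proj (h : IsCornerIsometry p t) : (p - t * star t) * p = p - t * star t := by
  rw [sub_mul, mul_assoc, h.star_mul_proj, h.proj_mul_self]

theorem compl_mul_self (h : IsCornerIsometry p t) :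
    (p - t * star t) * (p - t * star t) = p - t * star t := by
  conv_lhs => rw [mul_sub, ← mul_assoc, h.compl_mul, h.compl_mul_proj, zero_mul, sub_zero]

theorem norm_le_one (h : IsCornerIsometry p t) : ‖t‖ ≤ 1 := by
  have h1 : ‖p‖ * ‖p‖ = ‖p‖ := by
    rw [← CStarRing.norm_star_mul_self, h.star_proj, h.proj_mul_self]
  have h2 : ‖t‖ * ‖t‖ = ‖p‖ := by rw [← CStarRing.norm_star_mul_self, h.star_mul_self]
  have h3 : ‖p‖ ≤ 1 := by nlinarith [norm_nonneg p]
  nlinarith [norm_nonneg t]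

end IsCornerIsometry

/-- The sum `∑ cⁿ tⁿ x (t^*)ⁿ`. -/
noncomputable def dilate {A : Type*} [CStarAlgebra A] (c : ℂ) (t x : A) : A :=
  ∑' n : ℕ, c ^ n • (t ^ n * x * star t ^ n)

namespace IsDilation

variable {A : Type*} [CStarAlgebra A] {c : ℂ} {t x y y' : A}

theorem hasSum_dilate (ht : ‖t‖ ≤ 1) (hc : ‖c‖ < 1) (x : A) :
    HasSum (fun n : ℕ => c ^ n • (t ^ n * x * star t ^ n)) (dilate c t x) := by
  refine Summable.hasSum (Summable.of_norm_bounded_eventually_nat (g := fun n => ‖c‖ ^ n * ‖x‖)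
    ((summable_geometric_of_lt_one (norm_nonneg c) hc).mul_right _) ?_)
  filter_upwards [Filter.eventually_gt_atTop 0] with n hn
  have h1 : ‖t ^ n‖ ≤ 1 := (norm_pow_le' t hn).trans (pow_le_one₀ (norm_nonneg t) ht)
  have h2 : ‖star t ^ n‖ ≤ 1 := by rwa [← star_pow, norm_star]
  rw [norm_smul, norm_pow]
  gcongr
  calc ‖t ^ n * x * star t ^ n‖ ≤ ‖t ^ n‖ * ‖x‖ * ‖star t ^ n‖ := norm_mul₃_le
    _ ≤ 1 * ‖x‖ * 1 := by gcongr
    _ = ‖x‖ := by ring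

theorem isDilation_dilate (ht : ‖t‖ ≤ 1) (hc : ‖c‖ < 1) (x : A) :
    IsDilation c t x (dilate c t x) := by
  have h := hasSum_dilate ht hc x
  have h2 : HasSum (fun n : ℕ => c ^ (n + 1) • (t ^ (n + 1) * x * star t ^ (n + 1)))
      (c • (t * dilate c t x * star t)) := by
    have h' := ((h.mul_left t).mul_right (star t)).const_smul c
    rwa [show (fun n : ℕ => c • (t * c ^ n • (t ^ n * x * star t ^ n) * star t)) =
      fun n : ℕ => c ^ (n + 1) • (t ^ (n + 1) * x * star t ^ (n + 1)) from ?_] at h'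
    funext n
    rw [mul_smul_comm, smul_mul_assoc, smul_smul, ← pow_succ', pow_succ' t, pow_succ (star t)]
    simp only [mul_assoc]
  have h3 := (hasSum_nat_add_iff' (f := fun n : ℕ => c ^ n • (t ^ n * x * star t ^ n)) 1).2 h
  have := h3.unique h2
  simp only [Finset.range_one, Finset.sum_singleton, pow_zero, one_smul, one_mul, mul_one] at this
  rw [IsDilation, ← this]
  abel

theorem unique (ht : ‖t‖ ≤ 1) (hc : ‖c‖ < 1) (h : IsDilation c t x y) (h' : IsDilation c t x y') :
    y = y' := by
  have h0 := h.sub h'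
  rw [sub_self, IsDilation, zero_add] at h0
  rw [← sub_eq_zero, ← norm_eq_zero]
  set z := y - y'
  have h1 : ‖z‖ ≤ ‖c‖ * ‖z‖ := by
    calc ‖z‖ = ‖c • (t * z * star t)‖ := by rw [← h0]
      _ = ‖c‖ * ‖t * z * star t‖ := norm_smul _ _
      _ ≤ ‖c‖ * (‖t‖ * ‖z‖ * ‖star t‖) := by gcongr; exact norm_mul₃_le
      _ ≤ ‖c‖ * (1 * ‖z‖ * 1) := by rw [norm_star]; gcongr
      _ = ‖c‖ * ‖z‖ := by ring
  nlinarith [norm_nonneg z]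

theorem eq_dilate (ht : ‖t‖ ≤ 1) (hc : ‖c‖ < 1) (h : IsDilation c t x y) : y = dilate c t x :=
  h.unique ht hc (isDilation_dilate ht hc x)

theorem hasSum (ht : ‖t‖ ≤ 1) (hc : ‖c‖ < 1) (h : IsDilation c t x y) :
    HasSum (fun n : ℕ => c ^ n • (t ^ n * x * star t ^ n)) y :=
  h.eq_dilate ht hc ▸ hasSum_dilate ht hc x

section Corner

variable {p x₁ x₂ y₁ y₂ : A} {c₁ c₂ : ℂ}

theorem proj_mul (ht : IsCornerIsometry p t) (hx : (p - t * star t) * x = x)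
    (h : IsDilation c t x y) : p * y = y := by
  have hpx : p * x = x := by rw [← hx, ← mul_assoc, ht.proj_mul_compl]
  calc p * y = p * (x + c • (t * y * star t)) := by rw [← h]
    _ = x + c • (p * t * y * star t) := by
      rw [mul_add, hpx, mul_smul_comm]; simp only [mul_assoc]
    _ = y := by rw [ht.proj_mul, ← h]

theorem compl_mul (ht : IsCornerIsometry p t) (hx : (p - t * star t) * x = x)
    (h : IsDilation c t x y) : (p - t * star t) * y = x := by
  calc (p - t * star t) * y = (p - t * star t) * (x + c • (t * y * star t)) := by
        rw [← h]
    _ = x + c • ((p - t * star t) * t * y * star t) := by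
      rw [mul_add, hx, mul_smul_comm]; simp only [mul_assoc]
    _ = x := by rw [ht.compl_mul]; simp

theorem star_mul_eq (ht : IsCornerIsometry p t) (hx : (p - t * star t) * x = x)
    (h : IsDilation c t x y) : star t * y = c • (y * star t) := by
  have htx : star t * x = 0 := by rw [← hx, ← mul_assoc, ht.star_mul_compl, zero_mul]
  calc star t * y = star t * (x + c • (t * y * star t)) := by rw [← h]
    _ = c • (star t * t * y * star t) := by
      rw [mul_add, htx, mul_smul_comm, zero_add]; simp only [mul_assoc]
    _ = _ := by rw [ht.star_mul_self, h.proj_mul ht hx]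

theorem mul_eq {m : ℝ} (ht : IsCornerIsometry p t) (hx : x * (p - t * star t) = x)
    (h : IsDilation (m : ℂ) t x y) : y * t = (m : ℂ) • (t * y) := by
  have hx' : (p - t * star t) * star x = star x := by
    simpa [ht.star_proj] using congrArg star hx
  simpa using congrArg star (h.adjoint.star_mul_eq ht hx')

/-- Dilation is multiplicative on the corner of `p - t t^*`: the mixed terms vanish because `t^*` and
`t` annihilate this corner from the left and from the right. -/
theorem mul (ht : IsCornerIsometry p t) (hx₁ : x₁ * (p - t * star t) = x₁)
    (hx₂ : (p - t * star t) * x₂ = x₂) (h₁ : IsDilation c₁ t x₁ y₁)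
    (h₂ : IsDilation c₂ t x₂ y₂) : IsDilation (c₁ * c₂) t (x₁ * x₂) (y₁ * y₂) := by
  have h1 : x₁ * t = 0 := by rw [← hx₁, mul_assoc, ht.compl_mul, mul_zero]
  have h2 : star t * x₂ = 0 := by rw [← hx₂, ← mul_assoc, ht.star_mul_compl, zero_mul]
  calc y₁ * y₂ = (x₁ + c₁ • (t * y₁ * star t)) * (x₂ + c₂ • (t * y₂ * star t)) := by
        rw [← h₁, ← h₂]
    _ = x₁ * x₂ + c₂ • ((x₁ * t) * y₂ * star t) + c₁ • (t * y₁ * (star t * x₂)) +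
        (c₁ * c₂) • (t * y₁ * (star t * t * y₂) * star t) := by
      simp only [mul_add, add_mul, smul_mul_assoc, mul_smul_comm, mul_assoc, smul_smul, smul_add,
        mul_comm c₁ c₂]
      abel
    _ = _ := by
      rw [h1, h2, ht.star_mul_self, h₂.proj_mul ht hx₂]
      simp [mul_assoc]

end Corner

end IsDilation

/-! ### Square roots and the first generator -/

section SquareRoots

variable {A : Type*} [CStarAlgebra A] (m : ℝ)

/-- The positive element `(1 + m²Q)^{1/2}`. -/
noncomputable def sqrtOneAdd (Q : A) : A :=
  cfc (fun x : ℝ => √(1 + m ^ 2 * x)) Q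

/-- The positive element `(1 + m²Q)^{-1/2}`. -/
noncomputable def invSqrtOneAdd (Q : A) : A :=
  cfc (fun x : ℝ => (√(1 + m ^ 2 * x))⁻¹) Q

theorem star_sqrtOneAdd (Q : A) : star (sqrtOneAdd m Q) = sqrtOneAdd m Q :=
  (cfc_predicate _ Q : IsSelfAdjoint _)

theorem star_invSqrtOneAdd (Q : A) : star (invSqrtOneAdd m Q) = invSqrtOneAdd m Q :=
  (cfc_predicate _ Q : IsSelfAdjoint _)

variable [PartialOrder A] [StarOrderedRing A] {Q b : A}

theorem cfc_sqrt_eq_of_mul_self (h : b * b = Q) (hb : 0 ≤ b) : cfc Real.sqrt Q = b := by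
  have hQ : 0 ≤ Q := by
    rw [← h]
    exact (IsSelfAdjoint.of_nonneg hb).mul_self_nonneg
  rw [← CFC.sqrt_unique h hb, CFC.sqrt_eq_real_sqrt Q hQ, cfcₙ_eq_cfc]

theorem sqrtOneAdd_nonneg (Q : A) : 0 ≤ sqrtOneAdd m Q :=
  cfc_nonneg fun _ _ => Real.sqrt_nonneg _

theorem one_add_pos_of_mem_spectrum (hQ : 0 ≤ Q) {x : ℝ} (hx : x ∈ spectrum ℝ Q) :
    0 < 1 + m ^ 2 * x := by
  have := spectrum_nonneg_of_nonneg hQ hx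
  positivity

theorem sqrtOneAdd_mul_self (hQ : 0 ≤ Q) :
    sqrtOneAdd m Q * sqrtOneAdd m Q = 1 + (m : ℂ) ^ 2 • Q := by
  have hsa : IsSelfAdjoint Q := .of_nonneg hQ
  rw [sqrtOneAdd, ← cfc_mul (fun x : ℝ => √(1 + m ^ 2 * x)) (fun x : ℝ => √(1 + m ^ 2 * x)) Q,
    cfc_congr (g := fun x : ℝ => 1 + m ^ 2 * x)
      fun x hx => Real.mul_self_sqrt (one_add_pos_of_mem_spectrum m hQ hx).le,
    cfc_const_add 1 _ Q, cfc_const_mul_id _ Q, map_one]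
  congr 1
  rw [← Complex.ofReal_pow, Complex.coe_smul]

theorem continuousOn_inv_sqrt_one_add (hQ : 0 ≤ Q) :
    ContinuousOn (fun x : ℝ => (√(1 + m ^ 2 * x))⁻¹) (spectrum ℝ Q) :=
  ContinuousOn.inv₀ (by fun_prop) fun _ hx =>
    (Real.sqrt_pos.2 (one_add_pos_of_mem_spectrum m hQ hx)).ne'

theorem sqrtOneAdd_mul_invSqrtOneAdd (hQ : 0 ≤ Q) :
    sqrtOneAdd m Q * invSqrtOneAdd m Q = 1 := by
  have hsa : IsSelfAdjoint Q := .of_nonneg hQ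
  rw [sqrtOneAdd, invSqrtOneAdd, ← cfc_mul _ _ Q (by fun_prop) (continuousOn_inv_sqrt_one_add m hQ),
    ← cfc_one ℝ Q]
  exact cfc_congr fun x hx =>
    mul_inv_cancel₀ (Real.sqrt_pos.2 (one_add_pos_of_mem_spectrum m hQ hx)).ne'

theorem invSqrtOneAdd_mul_sqrtOneAdd (hQ : 0 ≤ Q) :
    invSqrtOneAdd m Q * sqrtOneAdd m Q = 1 := by
  simpa [star_sqrtOneAdd, star_invSqrtOneAdd] using
    congrArg star (sqrtOneAdd_mul_invSqrtOneAdd m hQ)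

end SquareRoots

section Isometry

variable {A : Type*} [CStarAlgebra A] {p t Q y : A} {m : ℝ}

theorem norm_ofReal_lt_one (hm : |m| < 1) : ‖(m : ℂ)‖ < 1 := by simpa using hm

theorem norm_ofReal_sq_lt_one (hm : |m| < 1) : ‖(m : ℂ) ^ 2‖ < 1 := by
  simpa using hm

/-- The isometric part `a (1 + m² a a^*)^{-1/2}` of a solution of `a^* a = p + m² a a^*`. -/
noncomputable def isometricPart (m : ℝ) (a : A) : A := a * invSqrtOneAdd m (a * star a)

theorem IsDilation.nonneg [PartialOrder A] [StarOrderedRing A] (ht : IsCornerIsometry p t)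
    (hm : |m| < 1) (h : IsDilation ((m : ℂ) ^ 2) t (t * star t) Q) : 0 ≤ Q := by
  refine (h.hasSum ht.norm_le_one (norm_ofReal_sq_lt_one hm)).nonneg fun n => ?_
  have h1 : t ^ n * (t * star t) * star t ^ n = t ^ (n + 1) * star (t ^ (n + 1)) := by
    rw [pow_succ, star_mul, star_pow]
    simp only [mul_assoc]
  have h2 : ((m : ℂ) ^ 2) ^ n = (((m ^ 2) ^ n : ℝ) : ℂ) := by push_cast; rfl
  rw [h1, h2, Complex.coe_smul]
  exact smul_nonneg (by positivity) (mul_star_self_nonneg _)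

theorem IsDilation.proj_mul_range (ht : IsCornerIsometry p t) {c : ℂ}
    (h : IsDilation c t (t * star t) Q) : p * Q = Q := by
  calc p * Q = p * (t * star t + c • (t * Q * star t)) := by rw [← h]
    _ = p * t * star t + c • (p * t * Q * star t) := by
      rw [mul_add, mul_smul_comm]; simp only [mul_assoc]
    _ = Q := by rw [ht.proj_mul, ← h]

theorem IsDilation.star_range (h : IsDilation ((m : ℂ) ^ 2) t (t * star t) Q)
    (hm : |m| < 1) (ht : IsCornerIsometry p t) : star Q = Q := by
  have h1 : IsDilation ((m ^ 2 : ℝ) : ℂ) t (t * star t) Q := by simpa using h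
  have h2 := h1.adjoint
  rw [star_mul, star_star] at h2
  push_cast at h2
  exact h2.unique ht.norm_le_one (norm_ofReal_sq_lt_one hm) h

theorem IsDilation.commute_proj (ht : IsCornerIsometry p t) (hm : |m| < 1)
    (h : IsDilation ((m : ℂ) ^ 2) t (t * star t) Q) : Commute Q p := by
  have h1 := h.proj_mul_range ht
  have h2 := congrArg star h1
  rw [star_mul, ht.star_proj, h.star_range hm ht] at h2
  exact h2.trans h1.symm

/-- For `Q = ∑ m²ⁿ tⁿ⁺¹ (t^*)ⁿ⁺¹` one has `Q^{1/2} t = t (1 + m²Q)^{1/2}`, since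
`t (1 + m²Q)^{1/2} t^*` is a positive square root of `Q`. -/
theorem IsDilation.sqrt_mul (ht : IsCornerIsometry p t) (hm : |m| < 1)
    (h : IsDilation ((m : ℂ) ^ 2) t (t * star t) Q) :
    cfc Real.sqrt Q * t = t * sqrtOneAdd m Q := by
  let _ := CStarAlgebra.spectralOrder A
  have := CStarAlgebra.spectralOrderedRing A
  have hk : Commute (sqrtOneAdd m Q) p := (h.commute_proj ht hm).cfc_real _
  have hR : t * sqrtOneAdd m Q * star t * (t * sqrtOneAdd m Q * star t) = Q := by
    calc _ = t * sqrtOneAdd m Q * (star t * t * sqrtOneAdd m Q) * star t := by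
          simp only [mul_assoc]
      _ = t * (sqrtOneAdd m Q * sqrtOneAdd m Q) * (p * star t) := by
          rw [ht.star_mul_self, ← hk.eq]; simp only [mul_assoc]
      _ = t * star t + (m : ℂ) ^ 2 • (t * Q * star t) := by
          rw [sqrtOneAdd_mul_self m (h.nonneg ht hm), ht.proj_mul_star]
          simp [mul_add, add_mul]
      _ = Q := h.symm
  rw [cfc_sqrt_eq_of_mul_self hR (star_right_conjugate_nonneg (sqrtOneAdd_nonneg m Q) t), mul_assoc,
    ht.star_mul_self, mul_assoc, hk.eq, ← mul_assoc, ht.mul_proj]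

theorem IsDilation.sqrt_mul_star_self (ht : IsCornerIsometry p t) (hm : |m| < 1)
    (h : IsDilation ((m : ℂ) ^ 2) t (t * star t) Q) :
    cfc Real.sqrt Q * t * star (cfc Real.sqrt Q * t) = Q := by
  let _ := CStarAlgebra.spectralOrder A
  have := CStarAlgebra.spectralOrderedRing A
  rw [h.sqrt_mul ht hm, star_mul, star_sqrtOneAdd]
  calc _ = t * (sqrtOneAdd m Q * sqrtOneAdd m Q) * star t := by simp only [mul_assoc]
    _ = t * star t + (m : ℂ) ^ 2 • (t * Q * star t) := by
      rw [sqrtOneAdd_mul_self m (h.nonneg ht hm)]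
      simp [mul_add, add_mul]
    _ = Q := h.symm

theorem IsDilation.sqrt_star_mul_self (ht : IsCornerIsometry p t) (hm : |m| < 1)
    (h : IsDilation ((m : ℂ) ^ 2) t (t * star t) Q) :
    star (cfc Real.sqrt Q * t) * (cfc Real.sqrt Q * t) = p + (m : ℂ) ^ 2 • Q := by
  let _ := CStarAlgebra.spectralOrder A
  have := CStarAlgebra.spectralOrderedRing A
  have hk : Commute (sqrtOneAdd m Q) p := (h.commute_proj ht hm).cfc_real _
  rw [h.sqrt_mul ht hm, star_mul, star_sqrtOneAdd]
  calc _ = sqrtOneAdd m Q * (star t * t) * sqrtOneAdd m Q := by simp only [mul_assoc]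
    _ = p * (sqrtOneAdd m Q * sqrtOneAdd m Q) := by rw [ht.star_mul_self, hk.eq, mul_assoc]
    _ = _ := by
      rw [sqrtOneAdd_mul_self m (h.nonneg ht hm), mul_add, mul_one, mul_smul_comm,
        h.proj_mul_range ht]

theorem IsDilation.isometricPart_sqrt_mul (ht : IsCornerIsometry p t) (hm : |m| < 1)
    (h : IsDilation ((m : ℂ) ^ 2) t (t * star t) Q) :
    isometricPart m (cfc Real.sqrt Q * t) = t := by
  let _ := CStarAlgebra.spectralOrder A
  have := CStarAlgebra.spectralOrderedRing A
  rw [isometricPart, h.sqrt_mul_star_self ht hm, h.sqrt_mul ht hm, mul_assoc,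
    sqrtOneAdd_mul_invSqrtOneAdd m (h.nonneg ht hm), mul_one]

/-- The isometric part of a solution of `a^* a = p + m² a a^*` is an isometry of the corner, and
`a a^*` is the corresponding sum. -/
theorem isCornerIsometry_isometricPart {a : A} (hp : star p = p) (hpp : p * p = p) (hpa : p * a = a)
    (h : star a * a = p + (m : ℂ) ^ 2 • (a * star a)) :
    IsCornerIsometry p (isometricPart m a) ∧
      IsDilation ((m : ℂ) ^ 2) (isometricPart m a) (isometricPart m a * star (isometricPart m a))
        (a * star a) ∧ a = isometricPart m a * sqrtOneAdd m (a * star a) := by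
  let _ := CStarAlgebra.spectralOrder A
  have := CStarAlgebra.spectralOrderedRing A
  have hQ : 0 ≤ a * star a := mul_star_self_nonneg a
  set k := sqrtOneAdd m (a * star a) with hkdef
  set r := invSqrtOneAdd m (a * star a) with hrdef
  have hrs : star r = r := star_invSqrtOneAdd m _
  have hks : star k = k := star_sqrtOneAdd m _
  have hrk : r * k = 1 := invSqrtOneAdd_mul_sqrtOneAdd m hQ
  have hkr : k * r = 1 := sqrtOneAdd_mul_invSqrtOneAdd m hQ
  have hkk : k * k = 1 + (m : ℂ) ^ 2 • (a * star a) := sqrtOneAdd_mul_self m hQ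
  have hpa' : star a * p = star a := by simpa [hp] using congrArg star hpa
  have hQp : Commute (a * star a) p := by
    rw [Commute, SemiconjBy, mul_assoc, hpa', ← mul_assoc, hpa]
  have hrp : Commute r p := hQp.cfc_real _
  have haa : star a * a = p * (k * k) := by
    rw [hkk, mul_add, mul_one, mul_smul_comm, ← mul_assoc, hpa, h]
  have hat : a = a * r * k := by rw [mul_assoc, hrk, mul_one]
  have hstar : star (a * r) = r * star a := by rw [star_mul, hrs]
  refine ⟨⟨hp, hpp, ?_, ?_⟩, ?_, hat⟩
  · calc star (a * r) * (a * r) = r * (star a * a) * r := by rw [hstar]; simp only [mul_assoc]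
      _ = p * ((r * k) * (k * r)) := by
        rw [haa, ← mul_assoc, hrp.eq]; simp only [mul_assoc]
      _ = p := by rw [hrk, hkr, mul_one, mul_one]
  · change p * (a * r) = a * r
    rw [← mul_assoc, hpa]
  · change a * star a = a * r * star (a * r) + (m : ℂ) ^ 2 • (a * r * (a * star a) * star (a * r))
    have : a * star a = a * r * (k * k) * star (a * r) := by
      conv_lhs => rw [hat]
      rw [star_mul, hks]
      simp only [mul_assoc]
    conv_lhs => rw [this, hkk]
    simp [mul_add, add_mul]

/-- An element that commutes with `t` and `t^*` up to the factor `m` commutes with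
`∑ m²ⁿ tⁿ⁺¹ (t^*)ⁿ⁺¹`. -/
theorem IsDilation.commute_of_twisted (ht : IsCornerIsometry p t) (hm : |m| < 1)
    (h : IsDilation ((m : ℂ) ^ 2) t (t * star t) Q) (h₁ : star t * y = (m : ℂ) • (y * star t))
    (h₂ : y * t = (m : ℂ) • (t * y)) : Commute Q y := by
  have h3 : ‖(m : ℂ) ^ 3‖ < 1 := by
    rw [norm_pow]
    exact pow_lt_one₀ (norm_nonneg _) (norm_ofReal_lt_one hm) (by norm_num)
  have hl : IsDilation ((m : ℂ) ^ 3) t ((m : ℂ) • (t * y * star t)) (Q * y) := by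
    calc Q * y = (t * star t + (m : ℂ) ^ 2 • (t * Q * star t)) * y := by rw [← h]
      _ = t * (star t * y) + (m : ℂ) ^ 2 • (t * Q * (star t * y)) := by
        simp only [add_mul, smul_mul_assoc, mul_assoc]
      _ = _ := by
        rw [h₁]
        simp only [mul_smul_comm, smul_smul, mul_assoc]
        congr 2
  have hr : IsDilation ((m : ℂ) ^ 3) t ((m : ℂ) • (t * y * star t)) (y * Q) := by
    calc y * Q = y * (t * star t + (m : ℂ) ^ 2 • (t * Q * star t)) := by rw [← h]
      _ = (y * t) * star t + (m : ℂ) ^ 2 • ((y * t) * Q * star t) := by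
        simp only [mul_add, mul_smul_comm, mul_assoc]
      _ = _ := by
        rw [h₂]
        simp only [smul_mul_assoc, smul_smul, mul_assoc]
        congr 2
  exact hl.unique ht.norm_le_one h3 hr

theorem sqrt_mul_twisted (ht : IsCornerIsometry p t) (hm : |m| < 1)
    (h : IsDilation ((m : ℂ) ^ 2) t (t * star t) Q) (h₁ : star t * y = (m : ℂ) • (y * star t))
    (h₂ : y * t = (m : ℂ) • (t * y)) :
    star (cfc Real.sqrt Q * t) * y = (m : ℂ) • (y * star (cfc Real.sqrt Q * t)) ∧
      y * (cfc Real.sqrt Q * t) = (m : ℂ) • (cfc Real.sqrt Q * t * y) := by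
  have hc : Commute (cfc Real.sqrt Q) y := (h.commute_of_twisted ht hm h₁ h₂).cfc_real _
  have hs : star (cfc Real.sqrt Q) = cfc Real.sqrt Q := (cfc_predicate _ Q : IsSelfAdjoint _)
  constructor
  · rw [star_mul, hs, mul_assoc, hc.eq, ← mul_assoc, h₁, smul_mul_assoc, mul_assoc]
  · rw [← mul_assoc, ← hc.eq, mul_assoc, h₂, mul_smul_comm, mul_assoc]

end Isometry

/-! ### One step: adding and removing a first generator -/

/-- The twisted canonical commutation relations for the elements `a_i`, `j ≤ i < d`, of the corner
of the projection `p`, whose unit is `p`. The family is indexed by `ℕ`; only the part `j ≤ i < d`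
matters. -/
structure IsCornerTCCR {A : Type*} [CStarAlgebra A] (m : ℝ) (p : A) (a : ℕ → A) (j d : ℕ) :
    Prop where
  star_proj : star p = p
  proj_mul_self : p * p = p
  proj_mul : ∀ i, j ≤ i → i < d → p * a i = a i
  mul_proj : ∀ i, j ≤ i → i < d → a i * p = a i
  star_mul_self : ∀ i, j ≤ i → i < d → star (a i) * a i = p + (m : ℂ) ^ 2 • (a i * star (a i))
    - (1 - (m : ℂ) ^ 2) • ∑ k ∈ Finset.Ico j i, a k * star (a k)
  star_mul : ∀ i k, j ≤ i → i < d → j ≤ k → k < d → i ≠ k →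
    star (a i) * a k = (m : ℂ) • (a k * star (a i))
  mul : ∀ i k, j ≤ i → i < k → k < d → a k * a i = (m : ℂ) • (a i * a k)

namespace IsCornerTCCR

variable {A : Type*} [CStarAlgebra A] {m : ℝ} {p t Q : A} {x a : ℕ → A} {j d : ℕ}

/-- Dilation of a solution in the corner of `p - t t^*`, with `Q^{1/2} t` as an additional first
generator, gives a solution in the corner of `p`. -/
theorem dilate (ht : IsCornerIsometry p t) (hm : |m| < 1)
    (hQ : IsDilation ((m : ℂ) ^ 2) t (t * star t) Q)
    (hx : IsCornerTCCR m (p - t * star t) x (j + 1) d) (hj : a j = cfc Real.sqrt Q * t)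
    (ha : ∀ i, j < i → i < d → IsDilation (m : ℂ) t (x i) (a i)) :
    IsCornerTCCR m p a j d := by
  have ht1 := ht.norm_le_one
  have hm2 := norm_ofReal_sq_lt_one hm
  have hmm : (m : ℂ) * m = (m : ℂ) ^ 2 := (sq _).symm
  have hl : ∀ i, j < i → i < d → (p - t * star t) * x i = x i := fun i h => hx.proj_mul i h
  have hr : ∀ i, j < i → i < d → x i * (p - t * star t) = x i := fun i h => hx.mul_proj i h
  have hl' : ∀ i, j < i → i < d → (p - t * star t) * star (x i) = star (x i) := fun i h h' => by
    simpa [ht.star_proj] using congrArg star (hr i h h')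
  have hr' : ∀ i, j < i → i < d → star (x i) * (p - t * star t) = star (x i) := fun i h h' => by
    simpa [ht.star_proj] using congrArg star (hl i h h')
  have htw : ∀ i, j < i → i < d → star (a j) * a i = (m : ℂ) • (a i * star (a j)) ∧
      a i * a j = (m : ℂ) • (a j * a i) := fun i h h' => by
    rw [hj]
    exact sqrt_mul_twisted ht hm hQ ((ha i h h').star_mul_eq ht (hl i h h'))
      ((ha i h h').mul_eq ht (hr i h h'))
  have hself : ∀ i, j < i → i < d →
      IsDilation ((m : ℂ) ^ 2) t (x i * star (x i)) (a i * star (a i)) := fun i h h' => by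
    simpa [hmm] using (ha i h h').mul ht (hr i h h') (hl' i h h') (ha i h h').adjoint
  have hPQ : a j * star (a j) = Q := by rw [hj, hQ.sqrt_mul_star_self ht hm]
  have hpd : IsDilation ((m : ℂ) ^ 2) t (p - t * star t + (1 - (m : ℂ) ^ 2) • (t * star t)) p := by
    rw [IsDilation, ht.mul_proj, sub_smul, one_smul]
    abel
  refine ⟨ht.star_proj, ht.proj_mul_self, ?_, ?_, ?_, ?_, ?_⟩
  · intro i h h'
    obtain rfl | h := h.eq_or_lt
    · rw [hj, hQ.sqrt_mul ht hm, ← mul_assoc, ht.proj_mul]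
    · exact (ha i h h').proj_mul ht (hl i h h')
  · intro i h h'
    obtain rfl | h := h.eq_or_lt
    · rw [hj, mul_assoc, ht.mul_proj]
    · simpa [ht.star_proj] using congrArg star ((ha i h h').adjoint.proj_mul ht (hl' i h h'))
  · intro i h h'
    obtain rfl | h := h.eq_or_lt
    · rw [hPQ, hj, hQ.sqrt_star_mul_self ht hm]
      simp
    · -- both sides are dilations of the corresponding expressions in `x` and `t t^*`
      have h1 : IsDilation ((m : ℂ) ^ 2) t (star (x i) * x i) (star (a i) * a i) := by
        simpa [hmm] using (ha i h h').adjoint.mul ht (hr' i h h') (hl i h h') (ha i h h')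
      have h2 := (hpd.add ((hself i h h').smul ((m : ℂ) ^ 2))).sub
        ((hQ.add (IsDilation.sum (Finset.Ico (j + 1) i) fun k hk =>
          hself k (Finset.mem_Ico.1 hk).1 ((Finset.mem_Ico.1 hk).2.trans h'))).smul
            (1 - (m : ℂ) ^ 2))
      rw [Finset.sum_eq_sum_Ico_succ_bot h, hPQ]
      refine h1.unique ht1 hm2 ?_
      rw [hx.star_mul_self i h h']
      convert h2 using 1
      rw [smul_add]
      abel
  · intro i k hi hi' hk hk' hik
    obtain rfl | hi := hi.eq_or_lt
    · exact (htw k (hk.lt_of_ne hik) hk').1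
    obtain rfl | hk := hk.eq_or_lt
    · simpa using congrArg star (htw i hi hi').1
    have h1 := (ha i hi hi').adjoint.mul ht (hr' i hi hi') (hl k hk hk') (ha k hk hk')
    have h2 := ((ha k hk hk').mul ht (hr k hk hk') (hl' i hi hi') (ha i hi hi').adjoint).smul m
    rw [hmm] at h1 h2
    rw [← hx.star_mul i k hi hi' hk hk' hik] at h2
    exact h1.unique ht1 hm2 h2
  · intro i k hi hik hk'
    obtain rfl | hi := hi.eq_or_lt
    · exact (htw k hik hk').2
    have hi' := hik.trans hk'
    have hk := hi.trans hik
    have h1 := (ha k hk hk').mul ht (hr k hk hk') (hl i hi hi') (ha i hi hi')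
    have h2 := ((ha i hi hi').mul ht (hr i hi hi') (hl k hk hk') (ha k hk hk')).smul m
    rw [hmm] at h1 h2
    rw [← hx.mul i k hi hik hk'] at h2
    exact h1.unique ht1 hm2 h2

theorem first_star_mul_self (ha : IsCornerTCCR m p a j d) (hjd : j < d) :
    star (a j) * a j = p + (m : ℂ) ^ 2 • (a j * star (a j)) := by
  simpa using ha.star_mul_self j le_rfl hjd

/-- The later generators commute with the isometric part of the first one and its adjoint up to the
factor `m`: they commute with `a_j a_j^*`, hence with the factor `(1 + m² a_j a_j^*)^{-1/2}`. -/
theorem twisted_isometricPart_first (ha : IsCornerTCCR m p a j d) (hjd : j < d) {i : ℕ}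
    (hi : j < i) (hid : i < d) :
    star (isometricPart m (a j)) * a i = (m : ℂ) • (a i * star (isometricPart m (a j))) ∧
      a i * isometricPart m (a j) = (m : ℂ) • (isometricPart m (a j) * a i) := by
  have h1 := ha.star_mul j i le_rfl hjd hi.le hid hi.ne
  have h2 := ha.mul j i le_rfl hi hid
  have hc : Commute (a j * star (a j)) (a i) := by
    rw [Commute, SemiconjBy, mul_assoc, h1, mul_smul_comm, ← mul_assoc, ← mul_assoc, h2,
      smul_mul_assoc]
  have hr : Commute (invSqrtOneAdd m (a j * star (a j))) (a i) := hc.cfc_real _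
  rw [isometricPart, StarMul.star_mul, star_invSqrtOneAdd]
  constructor
  · rw [mul_assoc, h1, mul_smul_comm, ← mul_assoc, hr.eq, mul_assoc]
  · rw [← mul_assoc, h2, smul_mul_assoc, mul_assoc, ← hr.eq, mul_assoc]

/-- The later generators are dilations of their compressions by `p - t t^*`, where `t` is the
isometric part of the first generator. -/
theorem isDilation_compress (ha : IsCornerTCCR m p a j d) (hjd : j < d) {i : ℕ}
    (hi : j < i) (hid : i < d) :
    IsDilation (m : ℂ) (isometricPart m (a j))
      ((p - isometricPart m (a j) * star (isometricPart m (a j))) * a i) (a i) := by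
  rw [IsDilation, sub_mul, ha.proj_mul i hi.le hid, mul_assoc,
    (ha.twisted_isometricPart_first hjd hi hid).1]
  simp [mul_assoc]

theorem commute_compl (ha : IsCornerTCCR m p a j d) (hjd : j < d) {i : ℕ}
    (hi : j < i) (hid : i < d) :
    Commute (p - isometricPart m (a j) * star (isometricPart m (a j))) (a i) := by
  obtain ⟨h1, h2⟩ := ha.twisted_isometricPart_first hjd hi hid
  rw [Commute, SemiconjBy, sub_mul, mul_sub, ha.proj_mul i hi.le hid, ha.mul_proj i hi.le hid,
    mul_assoc, h1, ← mul_assoc (a i), h2]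
  simp [mul_assoc]

theorem isCornerIsometry_isometricPart_first (ha : IsCornerTCCR m p a j d) (hjd : j < d) :
    IsCornerIsometry p (isometricPart m (a j)) ∧
      IsDilation ((m : ℂ) ^ 2) (isometricPart m (a j))
        (isometricPart m (a j) * star (isometricPart m (a j))) (a j * star (a j)) ∧
      a j = isometricPart m (a j) * sqrtOneAdd m (a j * star (a j)) :=
  isCornerIsometry_isometricPart ha.star_proj ha.proj_mul_self (ha.proj_mul j le_rfl hjd)
    (ha.first_star_mul_self hjd)

theorem first_eq_sqrt_mul (ha : IsCornerTCCR m p a j d) (hjd : j < d) (hm : |m| < 1) :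
    a j = cfc Real.sqrt (a j * star (a j)) * isometricPart m (a j) := by
  obtain ⟨h1, h2, h3⟩ := ha.isCornerIsometry_isometricPart_first hjd
  rw [h2.sqrt_mul h1 hm, ← h3]

/-- The compressions of the later generators by `p - t t^*`, where `t` is the isometric part of the
first generator, satisfy the relations in the corner of `p - t t^*`. -/
theorem compress (ha : IsCornerTCCR m p a j d) (hjd : j < d) :
    IsCornerTCCR m (p - isometricPart m (a j) * star (isometricPart m (a j)))
    (fun i => (p - isometricPart m (a j) * star (isometricPart m (a j))) * a i) (j + 1) d := by
  obtain ⟨ht, -, h3⟩ := ha.isCornerIsometry_isometricPart_first hjd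
  have hc := fun i h h' => (ha.commute_compl hjd (i := i) h h').eq
  set t := isometricPart m (a j)
  have hPa : (p - t * star t) * a j = 0 := by rw [h3, ← mul_assoc, ht.compl_mul, zero_mul]
  have hPp := ht.compl_mul_proj
  have hPP := ht.compl_mul_self
  have hPs := ht.star_compl
  set P := p - t * star t
  have hc' : ∀ i, j < i → i < d → star (a i) * P = P * star (a i) := fun i h h' => by
    simpa [hPs] using congrArg star (hc i h h')
  have hs : ∀ i, j < i → i < d → star (P * a i) = P * star (a i) := fun i h h' => by
    rw [StarMul.star_mul, hPs, hc' i h h']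
  have hmul : ∀ u v, P * u = u * P → P * u * (P * v) = P * (u * v) := fun u v h => by
    rw [h, mul_assoc, ← mul_assoc P, hPP, ← mul_assoc, ← h, mul_assoc]
  refine ⟨hPs, hPP, ?_, ?_, ?_, ?_, ?_⟩
  · intro i _ _
    rw [← mul_assoc, hPP]
  · intro i h h'
    rw [mul_assoc, ← hc i h h', ← mul_assoc, hPP]
  · intro i h h'
    have hsum : ∑ k ∈ Finset.Ico (j + 1) i, P * a k * star (P * a k) =
        P * ∑ k ∈ Finset.Ico j i, a k * star (a k) := by
      rw [Finset.sum_eq_sum_Ico_succ_bot h, mul_add, ← mul_assoc, hPa, zero_mul, zero_add,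
        Finset.mul_sum]
      refine Finset.sum_congr rfl fun k hk => ?_
      obtain ⟨hk, hk'⟩ := Finset.mem_Ico.1 hk
      rw [hs k hk (hk'.trans h'), hmul _ _ (hc k hk (hk'.trans h'))]
    rw [hsum, hs i h h', hmul _ _ (hc' i h h').symm, hmul _ _ (hc i h h'),
      ha.star_mul_self i (Nat.le_of_succ_le h) h', mul_sub, mul_add, hPp, mul_smul_comm,
      mul_smul_comm]
  · intro i k hi hi' hk hk' hik
    rw [hs i hi hi', hmul _ _ (hc' i hi hi').symm, hmul _ _ (hc k hk hk'),
      ha.star_mul i k (Nat.le_of_succ_le hi) hi' (Nat.le_of_succ_le hk) hk' hik, mul_smul_comm]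
  · intro i k hi hik hk'
    rw [hmul _ _ (hc k (hi.trans hik.le) hk'), hmul _ _ (hc i hi (hik.trans hk')),
      ha.mul i k (Nat.le_of_succ_le hi) hik hk', mul_smul_comm]

end IsCornerTCCR

/-! ### Iterating the steps -/

/-- A sequence `t_j`, `j < d`, of isometries of the corners of decreasing projections `p_j`, where
`p_0 = 1` and `p_{j+1} = p_j - t_j t_j^*`. -/
structure IsIsometryChain {A : Type*} [CStarAlgebra A] (p t : ℕ → A) (d : ℕ) : Prop where
  zero : p 0 = 1
  isCornerIsometry : ∀ j < d, IsCornerIsometry (p j) (t j)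
  succ : ∀ j < d, p (j + 1) = p j - t j * star (t j)

/-- The elements `b_i^{(j)}`, `j ≤ i < d`, obtained from `t` by successive dilations: `b_i^{(i)}` is
`Q^{1/2} t_i` with `Q = ∑ m²ⁿ t_iⁿ⁺¹ (t_i^*)ⁿ⁺¹`, and `b_i^{(j)} = ∑ mⁿ t_jⁿ b_i^{(j+1)} (t_j^*)ⁿ`. -/
structure IsDilationTower {A : Type*} [CStarAlgebra A] (m : ℝ) (t : ℕ → A) (b : ℕ → ℕ → A)
    (d : ℕ) : Prop where
  diag : ∀ i < d, ∃ Q, IsDilation ((m : ℂ) ^ 2) (t i) (t i * star (t i)) Q ∧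
    b i i = cfc Real.sqrt Q * t i
  step : ∀ i j, j < i → i < d → IsDilation (m : ℂ) (t j) (b i (j + 1)) (b i j)

namespace IsIsometryChain

variable {A : Type*} [CStarAlgebra A] {p t : ℕ → A} {d : ℕ}

theorem proj (h : IsIsometryChain p t d) {j : ℕ} (hj : j ≤ d) :
    star (p j) = p j ∧ p j * p j = p j := by
  cases j with
  | zero => simp [h.zero]
  | succ j =>
    have hc := h.isCornerIsometry j hj
    rw [h.succ j hj]
    exact ⟨hc.star_compl, hc.compl_mul_self⟩

theorem proj_mul_of_lt (h : IsIsometryChain p t d) {i j : ℕ} (hij : i < j) (hj : j ≤ d) :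
    p j * t i = 0 := by
  induction j, hij using Nat.le_induction with
  | base => rw [h.succ i hj, (h.isCornerIsometry i hj).compl_mul]
  | succ k hk ih =>
    have h1 : p k * t i = 0 := ih (Nat.le_of_succ_le hj)
    have h2 : star (t k) * t i = 0 := by
      rw [← (h.isCornerIsometry k hj).star_mul_proj, mul_assoc, h1, mul_zero]
    rw [h.succ k hj, sub_mul, h1, mul_assoc, h2, mul_zero, sub_zero]

theorem proj_eq (h : IsIsometryChain p t d) {j : ℕ} (hj : j ≤ d) :
    p j = 1 - ∑ k ∈ Finset.range j, t k * star (t k) := by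
  induction j with
  | zero => simp [h.zero]
  | succ j ih =>
    rw [h.succ j hj, ih (Nat.le_of_succ_le hj), Finset.sum_range_succ]
    abel

end IsIsometryChain

/-- A sum over `Fin d` below `i` is a sum over `Finset.range i` of the extension to `ℕ`. -/
theorem sum_Iio_eq_sum_range {B : Type*} [AddCommMonoid B] {d : ℕ} (f : ℕ → B) (i : Fin d) :
    ∑ k ∈ Finset.Iio i, f k = ∑ k ∈ Finset.range i, f k := by
  rw [← Nat.Iio_eq_range, ← Fin.map_valEmbedding_Iio, Finset.sum_map]
  rfl

/-- A chain satisfies the relations of the partial isometries `t_i`, with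
`p_j = 1 - ∑_{k < j} t_k t_k^*`. -/
theorem IsIsometryChain.isTwistedIsometries {A : Type*} [CStarAlgebra A] {p t : ℕ → A} {d : ℕ}
    (h : IsIsometryChain p t d) : IsTwistedIsometries fun i : Fin d => t i := by
  have h0 : ∀ i j : ℕ, i < j → j < d → star (t i) * t j = 0 := fun i j hij hj => by
    have h1 := congrArg star (h.proj_mul_of_lt hij hj.le)
    rw [star_mul, (h.proj hj.le).1, star_zero] at h1
    rw [← (h.isCornerIsometry j hj).proj_mul, ← mul_assoc, h1, zero_mul]
  constructor
  · intro i j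
    split_ifs with hij
    · subst hij
      rw [(h.isCornerIsometry i i.2).star_mul_self, h.proj_eq i.2.le,
        sum_Iio_eq_sum_range (fun k => t k * star (t k))]
    · rcases lt_or_gt_of_ne hij with hij | hij
      · exact h0 i j hij j.2
      · simpa using congrArg star (h0 j i hij i.2)
  · intro i j hij
    rw [← (h.isCornerIsometry j j.2).mul_proj, mul_assoc, h.proj_mul_of_lt hij j.2.le, mul_zero]

/-- The extension of a family by zero to a sequence. -/
def extendZero {A : Type*} [Zero A] {d : ℕ} (t : Fin d → A) (k : ℕ) : A :=
  if h : k < d then t ⟨k, h⟩ else 0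

@[simp]
theorem extendZero_coe {A : Type*} [Zero A] {d : ℕ} (t : Fin d → A) (i : Fin d) :
    extendZero t i = t i := by
  simp [extendZero]

theorem extendZero_of_lt {A : Type*} [Zero A] {d : ℕ} (t : Fin d → A) {i : ℕ} (h : i < d) :
    extendZero t i = t ⟨i, h⟩ := by
  simp [extendZero, h]

theorem IsTwistedIsometries.isIsometryChain {A : Type*} [CStarAlgebra A] {d : ℕ} {t : Fin d → A}
    (h : IsTwistedIsometries t) :
    IsIsometryChain (fun j => 1 - ∑ k ∈ Finset.range j, extendZero t k * star (extendZero t k))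
      (extendZero t) d := by
  set p : ℕ → A := fun j =>
    1 - ∑ k ∈ Finset.range j, extendZero t k * star (extendZero t k) with hpdef
  have hsucc : ∀ j, p (j + 1) = p j - extendZero t j * star (extendZero t j) := fun j => by
    simp only [hpdef, Finset.sum_range_succ]
    abel
  have hs : ∀ i : Fin d, star (t i) * t i = p i := fun i => by
    rw [h.star_mul, if_pos rfl, hpdef]
    simp only [← sum_Iio_eq_sum_range (fun k => extendZero t k * star (extendZero t k)),
      extendZero_coe]
  have hstar : ∀ j, star (p j) = p j := fun j => by simp [hpdef]
  have hpt : ∀ i : Fin d, p i * t i = t i := fun i => by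
    simp only [hpdef, ← sum_Iio_eq_sum_range (fun k => extendZero t k * star (extendZero t k)),
      extendZero_coe, sub_mul, one_mul, Finset.sum_mul]
    rw [Finset.sum_eq_zero, sub_zero]
    intro k hk
    rw [mul_assoc, h.star_mul, if_neg (Finset.mem_Iio.1 hk).ne, mul_zero]
  have htp : ∀ i : Fin d, t i * p i = t i := fun i => by
    simp only [hpdef, ← sum_Iio_eq_sum_range (fun k => extendZero t k * star (extendZero t k)),
      extendZero_coe, mul_sub, mul_one, Finset.mul_sum]
    rw [Finset.sum_eq_zero, sub_zero]
    intro k hk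
    rw [← mul_assoc, h.mul k i (Finset.mem_Iio.1 hk), zero_mul]
  refine ⟨by simp [hpdef], fun j hj => ?_, fun j _ => hsucc j⟩
  have := hs ⟨j, hj⟩
  have h1 := htp ⟨j, hj⟩
  rw [extendZero_of_lt t hj]
  refine ⟨hstar j, ?_, this, hpt ⟨j, hj⟩⟩
  calc p j * p j = star (t ⟨j, hj⟩) * (t ⟨j, hj⟩ * p j) := by rw [← mul_assoc, this]
    _ = p j := by rw [h1, this]

namespace IsDilationTower

variable {A : Type*} [CStarAlgebra A] {m : ℝ} {p t p' t' : ℕ → A} {b b' : ℕ → ℕ → A} {d : ℕ}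

theorem unique (hm : |m| < 1) (ht : IsIsometryChain p t d) (hb : IsDilationTower m t b d)
    (hb' : IsDilationTower m t b' d) {i j : ℕ} (hji : j ≤ i) (hi : i < d) : b i j = b' i j := by
  induction hji using Nat.decreasingInduction with
  | self =>
    obtain ⟨Q, hQ, h⟩ := hb.diag i hi
    obtain ⟨Q', hQ', h'⟩ := hb'.diag i hi
    rw [h, h', hQ.unique (ht.isCornerIsometry i hi).norm_le_one (norm_ofReal_sq_lt_one hm) hQ']
  | of_succ j hj ih =>
    have h := hb.step i j hj hi
    rw [ih] at h
    exact h.unique (ht.isCornerIsometry j (hj.trans hi)).norm_le_one (norm_ofReal_lt_one hm)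
      (hb'.step i j hj hi)

/-- The element `b_i^{(i - n)}` of the dilation tower. -/
noncomputable def towerAux (m : ℝ) (t : ℕ → A) (i : ℕ) : ℕ → A
  | 0 => cfc Real.sqrt (dilate ((m : ℂ) ^ 2) (t i) (t i * star (t i))) * t i
  | n + 1 => dilate (m : ℂ) (t (i - (n + 1))) (towerAux m t i n)

theorem exists_tower (hm : |m| < 1) (ht : IsIsometryChain p t d) :
    ∃ b, IsDilationTower m t b d := by
  refine ⟨fun i j => towerAux m t i (i - j), fun i hi => ⟨_, IsDilation.isDilation_dilate
    (ht.isCornerIsometry i hi).norm_le_one (norm_ofReal_sq_lt_one hm) _, ?_⟩, fun i j hj hi => ?_⟩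
  · rw [Nat.sub_self, towerAux]
  · have h1 : i - j = i - (j + 1) + 1 := by omega
    have h2 : i - (i - (j + 1) + 1) = j := by omega
    rw [h1, towerAux, h2]
    exact IsDilation.isDilation_dilate (ht.isCornerIsometry j (hj.trans hi)).norm_le_one
      (norm_ofReal_lt_one hm) _

/-- The elements `b_i^{(j)}`, `i ≥ j`, satisfy the twisted relations in the corner of `p_j`. -/
theorem isCornerTCCR (hm : |m| < 1) (ht : IsIsometryChain p t d) (hb : IsDilationTower m t b d)
    {j : ℕ} (hj : j ≤ d) : IsCornerTCCR m (p j) (fun i => b i j) j d := by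
  induction hj using Nat.decreasingInduction with
  | self =>
    obtain ⟨h1, h2⟩ := ht.proj le_rfl
    exact ⟨h1, h2, by omega, by omega, by omega, by omega, by omega⟩
  | of_succ j hj ih =>
    obtain ⟨Q, hQ, h⟩ := hb.diag j hj
    rw [ht.succ j hj] at ih
    exact ih.dilate (ht.isCornerIsometry j hj) hm hQ h fun i h h' => hb.step i j h h'

theorem proj_mul (hm : |m| < 1) (ht : IsIsometryChain p t d) (hb : IsDilationTower m t b d)
    {i j : ℕ} (hji : j ≤ i) (hi : i < d) : p j * b i 0 = b i j := by
  induction j with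
  | zero => rw [ht.zero, one_mul]
  | succ j ih =>
    have hc := ht.isCornerIsometry j (hji.trans hi.le)
    have hP := (hb.isCornerTCCR hm ht (hji.trans hi.le)).proj_mul i hji hi
    rw [ht.succ j (hji.trans hi.le)] at hP ⊢
    rw [← hc.compl_mul_proj, mul_assoc, ih (Nat.le_of_succ_le hji)]
    exact (hb.step i j hji hi).compl_mul hc hP

theorem mul_proj (hm : |m| < 1) (ht : IsIsometryChain p t d) (hb : IsDilationTower m t b d)
    {i j : ℕ} (hji : j ≤ i) (hi : i < d) : b i 0 * p j = b i j := by
  induction j with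
  | zero => rw [ht.zero, mul_one]
  | succ j ih =>
    have hc := ht.isCornerIsometry j (hji.trans hi.le)
    have hP := (hb.isCornerTCCR hm ht (hji.trans hi.le)).mul_proj i hji hi
    rw [ht.succ j (hji.trans hi.le)] at hP ⊢
    rw [← hc.proj_mul_compl, ← mul_assoc, ih (Nat.le_of_succ_le hji)]
    have hP' := congrArg star hP
    rw [star_mul, hc.star_compl] at hP'
    have h := congrArg star ((hb.step i j hji hi).adjoint.compl_mul hc hP')
    rwa [star_mul, hc.star_compl, star_star, star_star] at h

theorem isometricPart_diag (hm : |m| < 1) (ht : IsIsometryChain p t d)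
    (hb : IsDilationTower m t b d) {i : ℕ} (hi : i < d) : isometricPart m (b i i) = t i := by
  obtain ⟨Q, hQ, h⟩ := hb.diag i hi
  rw [h, hQ.isometricPart_sqrt_mul (ht.isCornerIsometry i hi) hm]

/-- The isometries are determined by the elements `b_i^{(0)}`. -/
theorem isometries_unique (hm : |m| < 1) (ht : IsIsometryChain p t d)
    (hb : IsDilationTower m t b d) (ht' : IsIsometryChain p' t' d) (hb' : IsDilationTower m t' b' d)
    (h : ∀ i < d, b i 0 = b' i 0) {i : ℕ} (hi : i < d) : t i = t' i := by
  have key : ∀ j < d, p j = p' j → t j = t' j := fun j hj hp => by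
    rw [← hb.isometricPart_diag hm ht hj, ← hb'.isometricPart_diag hm ht' hj,
      ← hb.proj_mul hm ht le_rfl hj, ← hb'.proj_mul hm ht' le_rfl hj, h j hj, hp]
  have hp : ∀ j ≤ d, p j = p' j := fun j => by
    induction j with
    | zero => rw [ht.zero, ht'.zero]; simp
    | succ j ih =>
      intro hj
      have hpj := ih (Nat.le_of_succ_le hj)
      rw [ht.succ j hj, ht'.succ j hj, hpj, key j hj hpj]
  exact key i hi (hp i hi.le)

end IsDilationTower

namespace IsCornerTCCR

variable {A : Type*} [CStarAlgebra A] {m : ℝ} {a : ℕ → A} {d : ℕ}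

/-- The projections `p_j` attached to the generators `a_i`: `p_{j+1} = p_j - t_j t_j^*`, where `t_j`
is the isometric part of `p_j a_j`. -/
noncomputable def compl (m : ℝ) (a : ℕ → A) : ℕ → A
  | 0 => 1
  | j + 1 => compl m a j -
      isometricPart m (compl m a j * a j) * star (isometricPart m (compl m a j * a j))

theorem compl_mul (ha : IsCornerTCCR m 1 a 0 d) {j : ℕ} (hj : j ≤ d) :
    IsCornerTCCR m (compl m a j) (fun i => compl m a j * a i) j d := by
  induction j with
  | zero => simpa [compl] using ha
  | succ j ih =>
    have ih := ih (Nat.le_of_succ_le hj)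
    have h1 := ih.compress hj
    obtain ⟨hc, -, -⟩ := ih.isCornerIsometry_isometricPart_first hj
    simp only [← mul_assoc, hc.compl_mul_proj] at h1
    exact h1

theorem isIsometryChain (ha : IsCornerTCCR m 1 a 0 d) :
    IsIsometryChain (compl m a) (fun j => isometricPart m (compl m a j * a j)) d :=
  ⟨rfl, fun _ hj => ((ha.compl_mul hj.le).isCornerIsometry_isometricPart_first hj).1,
    fun _ _ => rfl⟩

/-- The compressions `p_j a_i` are the dilation tower of the isometries attached to the `a_i`. -/
theorem isDilationTower (hm : |m| < 1) (ha : IsCornerTCCR m 1 a 0 d) :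
    IsDilationTower m (fun j => isometricPart m (compl m a j * a j)) (fun i j => compl m a j * a i)
      d := by
  refine ⟨fun i hi => ⟨_, ((ha.compl_mul hi.le).isCornerIsometry_isometricPart_first hi).2.1,
    (ha.compl_mul hi.le).first_eq_sqrt_mul hi hm⟩, fun i j hj hi => ?_⟩
  have hjd := hj.trans hi
  have h := (ha.compl_mul hjd.le).isDilation_compress hjd hj hi
  have hc := ((ha.compl_mul hjd.le).isCornerIsometry_isometricPart_first hjd).1
  rw [← mul_assoc, hc.compl_mul_proj] at h
  exact h

end IsCornerTCCR

/-! ### The universal property -/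

open scoped CStarAlgebra in
theorem StarAlgHom.continuous_of_cstarAlgebra {A B : Type*} [CStarAlgebra A] [CStarAlgebra B]
    (f : A →⋆ₐ[ℂ] B) : Continuous f :=
  map_continuous f

namespace OpRelation

variable {d : ℕ} {R R' : OpRelation d}

/-- The representation of the relations `R` by operators on the space of a representation of other
relations. -/
abbrev repOn (π : OpRep R') (op : Fin d → (π.H →L[ℂ] π.H)) (h : R π.H op) : OpRep R where
  H := π.H
  op := op
  rel := h

/-- Evaluation of a family of operators at a representation. -/
noncomputable def eval (π : OpRep R) : OpFamilies R →⋆ₐ[ℂ] (π.H →L[ℂ] π.H) where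
  toFun x := x.1 π
  map_one' := rfl
  map_mul' _ _ := rfl
  map_zero' := rfl
  map_add' _ _ := rfl
  commutes' _ := rfl
  map_star' _ := rfl

/-- A choice of a representation of `R` on the space of each representation of `R'` induces a
homomorphism between the algebras of families of operators. -/
noncomputable def pullback (op : ∀ π : OpRep R', Fin d → (π.H →L[ℂ] π.H))
    (h : ∀ π, R π.H (op π)) : OpFamilies R →⋆ₐ[ℂ] OpFamilies R' where
  toFun x := ⟨fun π => x.1 (repOn π (op π) (h π)), memℓp_infty (by
    obtain ⟨C, hC⟩ := memℓp_infty_iff.1 x.2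
    exact ⟨C, by rintro _ ⟨π, rfl⟩; exact hC ⟨_, rfl⟩⟩)⟩
  map_one' := rfl
  map_mul' _ _ := rfl
  map_zero' := rfl
  map_add' _ _ := rfl
  commutes' _ := rfl
  map_star' _ := rfl

variable {hR : R.IsBounded} {hR' : R'.IsBounded}

theorem hom_ext {B : Type*} [CStarAlgebra B] {f g : R.UniversalCStar hR →⋆ₐ[ℂ] B}
    (h : ∀ i, f (R.gen hR i) = g (R.gen hR i)) : f = g := by
  have hf : Continuous f := f.continuous_of_cstarAlgebra
  have hg : Continuous g := g.continuous_of_cstarAlgebra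
  refine StarAlgHom.ext_topologicalClosure (R := ℂ) (A := OpFamilies R)
    (S := StarAlgebra.adjoin ℂ (Set.range (R.universalOp hR))) hf hg ?_
  refine StarAlgHom.ext_adjoin ?_
  rintro ⟨_, hx⟩ ⟨i, rfl⟩
  exact h i

/-- The inclusion of the universal `C^*`-algebra into the families of operators. -/
noncomputable def inclusion (hR : R.IsBounded) : R.UniversalCStar hR →⋆ₐ[ℂ] OpFamilies R :=
  (R.universalSubalgebra hR).subtype

/-- The representation of the universal `C^*`-algebra given by a representation of the
relations. -/
noncomputable def toRep (hR : R.IsBounded) (π : OpRep R) :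
    R.UniversalCStar hR →⋆ₐ[ℂ] (π.H →L[ℂ] π.H) :=
  (eval π).comp (inclusion hR)

theorem ext_of_toRep {x y : R.UniversalCStar hR} (h : ∀ π, toRep hR π x = toRep hR π y) : x = y :=
  Subtype.ext (Subtype.ext (funext h))

/-- The universal property, for targets that are themselves universal `C^*`-algebras:
through the elements `b_i` each representation of `R'` gives one of `R` on the same space, and the
homomorphism is the pullback along this assignment. -/
theorem exists_lift (b : Fin d → R'.UniversalCStar hR')
    (hb : ∀ π : OpRep R', R π.H fun i => toRep hR' π (b i)) :
    ∃ f : R.UniversalCStar hR →⋆ₐ[ℂ] R'.UniversalCStar hR', ∀ i, f (R.gen hR i) = b i := by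
  let G : OpFamilies R →⋆ₐ[ℂ] OpFamilies R' :=
    pullback (fun π i => toRep hR' π (b i)) hb
  have hG : Continuous G := G.continuous_of_cstarAlgebra
  let F := G.comp (inclusion hR)
  have hF : ∀ i, F (R.gen hR i) = inclusion hR' (b i) := fun i => rfl
  have hmem : ∀ x, F x ∈ R'.universalSubalgebra hR' := by
    have h1 : R.universalSubalgebra hR ≤ (R'.universalSubalgebra hR').comap G := by
      refine StarSubalgebra.topologicalClosure_minimal ?_ ?_
      · rw [StarAlgebra.adjoin_le_iff]
        rintro _ ⟨i, rfl⟩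
        exact (b i).2
      · exact (StarSubalgebra.isClosed_topologicalClosure _).preimage hG
    exact fun x => h1 x.2
  exact ⟨F.codRestrict (R'.universalSubalgebra hR') hmem, fun i => Subtype.ext (hF i)⟩

end OpRelation

/-! ### Polar decompositions -/

section PolarDecomposition

variable {H : Type*} [NormedAddCommGroup H] [InnerProductSpace ℂ H] [CompleteSpace H]

theorem norm_apply_eq_of_star_mul_self {T C : H →L[ℂ] H} (h : star T * T = star C * C) (x : H) :
    ‖T x‖ = ‖C x‖ := by
  have key : ∀ S : H →L[ℂ] H, ((‖S x‖ ^ 2 : ℝ) : ℂ) = inner ℂ x ((star S * S) x) := fun S => by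
    rw [mul_apply_eq_comp, ContinuousLinearMap.star_eq_adjoint,
      ContinuousLinearMap.adjoint_inner_right, inner_self_eq_norm_sq_to_K]
    simp
  have h1 : ‖T x‖ ^ 2 = ‖C x‖ ^ 2 := by
    have := key T
    rw [h, ← key C] at this
    exact_mod_cast this
  exact (pow_left_inj₀ (norm_nonneg _) (norm_nonneg _) two_ne_zero).1 h1

/-- Every bounded operator `T` has a polar decomposition, whose positive part is
`(T^* T)^{1/2}`. -/
theorem exists_isPolarDecomposition (T : H →L[ℂ] H) :
    ∃ U : H →L[ℂ] H, IsPolarDecomposition T U (CFC.sqrt (star T * T)) := by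
  set C := CFC.sqrt (star T * T) with hC
  have hC0 : 0 ≤ C := CFC.sqrt_nonneg _
  have hCC : star C * C = star T * T := by
    rw [(IsSelfAdjoint.of_nonneg hC0).star_eq]
    exact CFC.sqrt_mul_sqrt_self _ (star_mul_self_nonneg T)
  have hnorm : ∀ x, ‖T x‖ = ‖C x‖ := norm_apply_eq_of_star_mul_self hCC.symm
  let K : Submodule ℂ H := C.range.topologicalClosure
  have hK : IsClosed (K : Set H) := Submodule.isClosed_topologicalClosure _
  have : CompleteSpace K := hK.completeSpace_coe
  have hCK : ∀ x, C x ∈ K := fun x => C.range.le_topologicalClosure ⟨x, rfl⟩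
  let e : H →ₗ[ℂ] K := (C : H →ₗ[ℂ] H).codRestrict K hCK
  have he : DenseRange e := by
    have h1 : Set.range C ⊆ Subtype.val '' Set.range e := by
      rintro _ ⟨x, rfl⟩
      exact ⟨e x, ⟨x, rfl⟩, rfl⟩
    rw [DenseRange, Subtype.dense_iff]
    exact fun x hx => closure_mono h1 hx
  have hb : ∀ x, ‖(T : H →ₗ[ℂ] H) x‖ ≤ 1 * ‖e x‖ := fun x => by
    rw [one_mul]
    exact (hnorm x).le
  let V : K →L[ℂ] H := (T : H →ₗ[ℂ] H).extendOfNorm e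
  have hV : ∀ x, V (e x) = T x := LinearMap.extendOfNorm_eq he ⟨1, hb⟩
  have hVn : ∀ k, ‖V k‖ = ‖k‖ := fun k => by
    refine he.induction_on k (isClosed_eq (by fun_prop) (by fun_prop)) fun x => ?_
    rw [hV, hnorm]
    rfl
  let W : K →ₗᵢ[ℂ] H := ⟨V, hVn⟩
  let U : H →L[ℂ] H := V.comp K.orthogonalProjectionOnto
  have hU : ∀ x, U x = W (K.orthogonalProjectionOnto x) := fun _ => rfl
  have hUU : star U * U = K.starProjection := by
    ext x
    refine ext_inner_left ℂ fun y => ?_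
    rw [mul_apply_eq_comp, ContinuousLinearMap.star_eq_adjoint,
      ContinuousLinearMap.adjoint_inner_right, hU, hU, W.inner_map_map, Submodule.coe_inner]
    change inner ℂ (K.starProjection y) (K.starProjection x) = _
    rw [Submodule.inner_starProjection_left_eq_right, ← mul_apply_eq_comp,
      K.isIdempotentElem_starProjection.eq]
  refine ⟨U, ⟨?_, ?_, ?_, fun x => ?_⟩⟩
  · ext x
    rw [mul_apply_eq_comp, hU]
    have : K.orthogonalProjectionOnto (C x) = e x :=
      K.orthogonalProjectionOnto_mem_subspace_eq_self (e x)
    rw [this]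
    exact (hV x).symm
  · exact (ContinuousLinearMap.nonneg_iff_isPositive _).1 hC0
  · rw [mul_assoc, hUU]
    ext x
    rw [mul_apply_eq_comp, hU, hU, Submodule.starProjection_apply,
      Submodule.orthogonalProjectionOnto_mem_subspace_eq_self]
  · rw [hU, map_eq_zero_iff W W.injective, Submodule.orthogonalProjectionOnto_eq_zero_iff,
      Submodule.orthogonal_closure, Submodule.mem_orthogonal]
    have hsym : ∀ y, inner ℂ (C y) x = inner ℂ y (C x) := fun y =>
      (IsSelfAdjoint.of_nonneg hC0).isSymmetric y x
    constructor
    · intro h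
      rw [← inner_self_eq_zero (𝕜 := ℂ), ← hsym]
      exact h _ ⟨_, rfl⟩
    · rintro h _ ⟨y, rfl⟩
      exact (hsym y).trans (by rw [h, inner_zero_right])

/-- The compression of the partial isometry `S` in the polar decomposition `a^* = S^* C` by a
projection `p` that commutes with `a`. -/
theorem IsPolarDecomposition.proj_mul_eq {a S C p t w : H →L[ℂ] H}
    (h : IsPolarDecomposition (star a) (star S) C) (hC : C * C = a * star a)
    (hp : star p = p) (hpp : p * p = p) (hpa : p * a = a * p) (hpt : p * t = t)
    (ht : p * a = cfc Real.sqrt (p * a * star (p * a)) * t) (hw : t = p * a * w) :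
    p * S = t := by
  have hC0 : 0 ≤ C := (ContinuousLinearMap.nonneg_iff_isPositive _).2 h.isPositive
  have hCs : star C = C := (IsSelfAdjoint.of_nonneg hC0).star_eq
  have hker : ∀ X : H →L[ℂ] H, C * X = 0 ↔ star S * X = 0 := fun X => by
    simp only [ContinuousLinearMap.ext_iff, mul_apply_eq_comp, zero_apply, h.ker_eq]
  have ha : a = C * S := by simpa [hCs] using congrArg star h.eq_mul
  have hSS : S * star S * S = S := by simpa [mul_assoc] using congrArg star h.partialIsometry
  have hSS' : star S * S * star S = star S := by simpa using h.partialIsometry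
  have hpa' : star a * p = p * star a := by simpa [hp] using congrArg star hpa
  have hCc : C = cfc Real.sqrt (a * star a) := (cfc_sqrt_eq_of_mul_self hC hC0).symm
  have hcomm : Commute C p := by
    have : Commute (a * star a) p := by
      rw [Commute, SemiconjBy, mul_assoc, hpa', ← mul_assoc, ← hpa, mul_assoc]
    rw [hCc]
    exact this.cfc_real _
  -- `p C = p C p` is the positive square root of `p a a^* p`
  have hroot : cfc Real.sqrt (p * a * star (p * a)) = p * C * p := by
    refine cfc_sqrt_eq_of_mul_self ?_ ?_
    · calc p * C * p * (p * C * p) = p * C * (p * p) * C * p := by simp only [mul_assoc]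
        _ = p * (C * p) * C * p := by rw [hpp]; simp only [mul_assoc]
        _ = p * p * (C * C) * p := by rw [hcomm.eq]; simp only [mul_assoc]
        _ = p * a * star (p * a) := by rw [hpp, hC, star_mul, hp]; simp only [mul_assoc]
    · simpa [hp] using star_right_conjugate_nonneg hC0 p
  have hCt : C * t = p * a := by
    rw [ht, hroot]
    conv_rhs => rw [← hcomm.eq, mul_assoc C, hpp, mul_assoc, hpt]
  have h1 : star S * (p * S) = star S * t := by
    rw [← sub_eq_zero, ← mul_sub, ← hker, mul_sub, hCt, ← mul_assoc, hcomm.eq, mul_assoc, ← ha,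
      sub_self]
  have hE1 : C * (1 - S * star S) = 0 := by
    rw [hker, mul_sub, mul_one, ← mul_assoc, hSS', sub_self]
  have hEC : S * star S * C = C := by
    have := congrArg star hE1
    rw [star_mul, star_zero, hCs, star_sub, star_mul, star_star, star_one, sub_mul, one_mul,
      sub_eq_zero] at this
    exact this.symm
  have hEp : p * (S * star S) = S * star S * p * (S * star S) := by
    have h2 : C * (p * (1 - S * star S)) = 0 := by
      rw [← mul_assoc, hcomm.eq, mul_assoc, hE1, mul_zero]
    rw [hker, mul_sub, mul_sub, mul_one, sub_eq_zero] at h2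
    have h3 : S * star S * p = S * star S * p * (S * star S) := by
      simpa only [mul_assoc] using congrArg (S * ·) h2
    have h4 := congrArg star h3
    simp only [star_mul, star_star, hp] at h4
    simpa only [mul_assoc] using h4
  have hEt : S * star S * t = t := by
    have : t = C * (S * p * w) := by rw [hw, hpa, ha]; simp only [mul_assoc]
    rw [this, ← mul_assoc, hEC]
  calc p * S = p * (S * star S) * S := by rw [mul_assoc, hSS]
    _ = S * star S * p * (S * star S * S) := by rw [hEp, mul_assoc]
    _ = S * (star S * (p * S)) := by rw [hSS]; simp only [mul_assoc]
    _ = t := by rw [h1, ← mul_assoc, hEt]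

/-- For the polar decompositions `a_i^* = S_i^* C_i` of the elements obtained from `t`, the partial
isometries `t_i` are the `Ŝ_i`. -/
theorem IsDilationTower.hatS_eq {m : ℝ} {p t : ℕ → H →L[ℂ] H} {b : ℕ → ℕ → H →L[ℂ] H} {d : ℕ}
    (hm : |m| < 1) (ht : IsIsometryChain p t d) (hb : IsDilationTower m t b d)
    {S C : Fin d → H →L[ℂ] H}
    (hS : ∀ i : Fin d, IsPolarDecomposition (star (b i 0)) (star (S i)) (C i))
    (hC : ∀ i : Fin d, C i * C i = b i 0 * star (b i 0)) (i : Fin d) : hatS S i = t i := by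
  induction i using WellFoundedLT.induction with
  | ind i ih =>
  have hsum : 1 - ∑ j : {j : Fin d // j < i}, hatS S j.1 * star (hatS S j.1) = p i := by
    rw [ht.proj_eq i.2.le, ← sum_Iio_eq_sum_range (fun k => t k * star (t k))]
    congr 1
    rw [Finset.sum_congr rfl fun (j : {j : Fin d // j < i}) _ => by rw [ih j.1 j.2]]
    exact (Finset.sum_subtype (Finset.Iio i) (fun _ => Finset.mem_Iio)
      (fun k : Fin d => t k * star (t k))).symm
  have hbi := hb.proj_mul hm ht le_rfl i.2
  have hc := ht.isCornerIsometry i i.2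
  obtain ⟨Q, hQ, hd⟩ := hb.diag i i.2
  rw [hatS, hsum]
  refine (hS i).proj_mul_eq (hC i) hc.star_proj hc.proj_mul_self
    (hbi.trans (hb.mul_proj hm ht le_rfl i.2).symm) hc.proj_mul
    (w := invSqrtOneAdd m (b i i * star (b i i))) ?_ ?_
  · rw [hbi, hd, hQ.sqrt_mul_star_self hc hm]
  · rw [hbi]
    exact (hb.isometricPart_diag hm ht i.2).symm

end PolarDecomposition

/-! ### Images under homomorphisms -/

section Map

variable {A B : Type*} [CStarAlgebra A] [CStarAlgebra B] (f : A →⋆ₐ[ℂ] B) {d : ℕ}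

theorem IsTCCR.map {μ : ℝ} {a : Fin d → A} (h : IsTCCR μ a) : IsTCCR μ fun i => f (a i) where
  star_mul_self i := by
    simp only [← map_star f, ← map_mul f, ← map_sum f, ← map_smul f, ← map_one f, ← map_add f,
      ← map_sub f, h.star_mul_self i]
  star_mul i j hij := by
    simp only [← map_star f, ← map_mul f, ← map_smul f, h.star_mul i j hij]
  mul i j hij := by simp only [← map_mul f, ← map_smul f, h.mul i j hij]

theorem IsTwistedIsometries.map {t : Fin d → A} (h : IsTwistedIsometries t) :
    IsTwistedIsometries fun i => f (t i) where
  star_mul i j := by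
    simp only [← map_star f, ← map_mul f, ← map_sum f, ← map_one f, ← map_sub f, ← map_zero f,
      ← apply_ite f, h.star_mul i j]
  mul i j hij := by simp only [← map_mul f, h.mul i j hij, map_zero f]

theorem IsDilation.map {c : ℂ} {t x y : A} (h : IsDilation c t x y) :
    IsDilation c (f t) (f x) (f y) := by
  rw [IsDilation, ← map_star, ← map_mul, ← map_mul, ← map_smul, ← map_add, ← h]

theorem IsCornerIsometry.map {p t : A} (h : IsCornerIsometry p t) :
    IsCornerIsometry (f p) (f t) where
  star_proj := by rw [← map_star, h.star_proj]
  proj_mul_self := by rw [← map_mul, h.proj_mul_self]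
  star_mul_self := by rw [← map_star, ← map_mul, h.star_mul_self]
  proj_mul := by rw [← map_mul, h.proj_mul]

theorem IsIsometryChain.map {p t : ℕ → A} (h : IsIsometryChain p t d) :
    IsIsometryChain (fun j => f (p j)) (fun j => f (t j)) d where
  zero := by rw [h.zero, map_one]
  isCornerIsometry j hj := (h.isCornerIsometry j hj).map f
  succ j hj := by rw [h.succ j hj, map_sub, map_mul, map_star]

theorem IsDilationTower.map {m : ℝ} (hm : |m| < 1) {p t : ℕ → A} {b : ℕ → ℕ → A}
    (ht : IsIsometryChain p t d) (h : IsDilationTower m t b d) :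
    IsDilationTower m (fun j => f (t j)) (fun i j => f (b i j)) d where
  diag i hi := by
    obtain ⟨Q, hQ, hd⟩ := h.diag i hi
    have hs : IsSelfAdjoint Q := hQ.star_range hm (ht.isCornerIsometry i hi)
    have hf : Continuous f := f.continuous_of_cstarAlgebra
    refine ⟨f Q, by simpa only [map_mul, map_star f] using hQ.map f, ?_⟩
    rw [hd, map_mul, StarAlgHom.map_cfc f Real.sqrt Q (by fun_prop) hf hs (hs.map f)]
  step i j hj hi := (h.step i j hj hi).map f

end Map

theorem IsDilationTower.congr {A : Type*} [CStarAlgebra A] {m : ℝ} {t t' : ℕ → A}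
    {b : ℕ → ℕ → A} {d : ℕ} (h : IsDilationTower m t b d) (ht : ∀ i < d, t i = t' i) :
    IsDilationTower m t' b d where
  diag i hi := ht i hi ▸ h.diag i hi
  step i j hj hi := ht j (hj.trans hi) ▸ h.step i j hj hi

section Reflect

variable {d : ℕ} {R : OpRelation d} {hR : R.IsBounded}

open OpRelation

theorem isTCCR_of_toRep {μ : ℝ} {a : Fin d → R.UniversalCStar hR}
    (h : ∀ π : OpRep R, IsTCCR μ fun i => toRep hR π (a i)) : IsTCCR μ a where
  star_mul_self i := ext_of_toRep fun π => by
    refine ((h π).star_mul_self i).trans (Eq.symm ?_)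
    simp only [map_sub, map_add, map_one, map_smul, map_sum, map_mul, map_star (toRep hR π)]
  star_mul i j hij := ext_of_toRep fun π => by
    simpa only [map_smul, map_mul, map_star (toRep hR π)] using (h π).star_mul i j hij
  mul i j hij := ext_of_toRep fun π => by
    simpa only [map_smul, map_mul] using (h π).mul i j hij

theorem isTwistedIsometries_of_toRep {t : Fin d → R.UniversalCStar hR}
    (h : ∀ π : OpRep R, IsTwistedIsometries fun i => toRep hR π (t i)) :
    IsTwistedIsometries t where
  star_mul i j := ext_of_toRep fun π => by
    refine ((h π).star_mul i j).trans (Eq.symm ?_)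
    simp only [apply_ite (toRep hR π), map_sub, map_one, map_zero, map_sum, map_mul,
      map_star (toRep hR π)]
  mul i j hij := ext_of_toRep fun π => by
    simpa only [map_mul, map_zero] using (h π).mul i j hij

end Reflect

/-! ### The isomorphism -/

theorem TCCRAlgebra.isTCCR (d : ℕ) (μ : ℝ) (hμ : μ ∈ Set.Ioo (-1 : ℝ) 1) :
    IsTCCR μ (TCCRAlgebra.a d μ hμ) :=
  isTCCR_of_toRep fun π => π.rel

theorem TwistedIsometryAlgebra.isTwistedIsometries (d : ℕ) :
    IsTwistedIsometries (TwistedIsometryAlgebra.t d) :=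
  isTwistedIsometries_of_toRep fun π => π.rel

section Convert

variable {A : Type*} [CStarAlgebra A] {d : ℕ} {μ : ℝ}

theorem IsTCCR.isCornerTCCR {a : Fin d → A} (h : IsTCCR μ a) :
    IsCornerTCCR μ 1 (extendZero a) 0 d where
  star_proj := star_one _
  proj_mul_self := one_mul _
  proj_mul _ _ _ := one_mul _
  mul_proj _ _ _ := mul_one _
  star_mul_self i _ hi := by
    have := h.star_mul_self ⟨i, hi⟩
    rw [Nat.Ico_zero_eq_range,
      ← sum_Iio_eq_sum_range (fun k => extendZero a k * star (extendZero a k)) ⟨i, hi⟩]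
    simpa [extendZero_of_lt a hi] using this
  star_mul i k _ hi _ hk hik := by
    rw [extendZero_of_lt a hi, extendZero_of_lt a hk]
    exact h.star_mul _ _ (by simpa using hik)
  mul i k _ hik hk := by
    rw [extendZero_of_lt a hk, extendZero_of_lt a (hik.trans hk)]
    exact h.mul _ _ hik

theorem IsCornerTCCR.isTCCR {a : ℕ → A} (h : IsCornerTCCR μ 1 a 0 d) :
    IsTCCR μ fun i : Fin d => a i where
  star_mul_self i := by
    have := h.star_mul_self i (Nat.zero_le _) i.2
    rw [Nat.Ico_zero_eq_range, ← sum_Iio_eq_sum_range (fun k => a k * star (a k))] at this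
    simpa using this
  star_mul i j hij :=
    h.star_mul i j (Nat.zero_le _) i.2 (Nat.zero_le _) j.2 (by simpa [Fin.ext_iff] using hij)
  mul i j hij := h.mul i j (Nat.zero_le _) hij j.2

theorem IsDilationTower.isTildeFamily (hμ : |μ| < 1) {p : ℕ → A} {t : Fin d → A} {b : ℕ → ℕ → A}
    (ht : IsIsometryChain p (extendZero t) d) (h : IsDilationTower μ (extendZero t) b d) :
    IsTildeFamily μ t fun i j => b i j where
  diag i := by
    obtain ⟨Q, hQ, hd⟩ := h.diag i i.2
    have hs := hQ.hasSum (ht.isCornerIsometry i i.2).norm_le_one (norm_ofReal_sq_lt_one hμ)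
    rw [extendZero_coe] at hs hd
    refine ⟨Q, ?_, hd⟩
    convert hs using 2 with n
    rw [pow_succ, pow_succ' (star (t i)), pow_mul]
    push_cast
    simp only [mul_assoc]
  step i j hj := by
    have hs := (h.step i j hj i.2).hasSum (ht.isCornerIsometry j j.2).norm_le_one
      (norm_ofReal_lt_one hμ)
    rw [extendZero_coe] at hs
    simpa using hs

end Convert

theorem corollary2 (d : ℕ) (μ : ℝ) (hμ : μ ∈ Set.Ioo (-1 : ℝ) 1) :
    ∃ φ : TwistedIsometryAlgebra d ≃⋆ₐ[ℂ] TCCRAlgebra d μ hμ,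
      -- `φ(t_i) = Ŝ_i`, in every Hilbert space realisation `ρ` of `A_μ`
      (∀ (H : Type*) [NormedAddCommGroup H] [InnerProductSpace ℂ H] [CompleteSpace H]
        (ρ : TCCRAlgebra d μ hμ →⋆ₐ[ℂ] (H →L[ℂ] H)),
        ∃ S C : Fin d → (H →L[ℂ] H),
          (∀ i, IsPolarDecomposition (star (ρ (TCCRAlgebra.a d μ hμ i))) (star (S i)) (C i)) ∧
          ∀ i, ρ (φ (TwistedIsometryAlgebra.t d i)) = hatS S i) ∧
      -- `φ⁻¹(a_i) = ã_i`
      ∃ b : Fin d → ℕ → TwistedIsometryAlgebra d,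
        IsTildeFamily μ (TwistedIsometryAlgebra.t d) b ∧
        ∀ i, φ.symm (TCCRAlgebra.a d μ hμ i) = b i 0 := by
  have hm : |μ| < 1 := abs_lt.2 hμ
  -- the elements `ã_i` of `A_0` and the homomorphism `ψ` with `ψ(a_i) = ã_i`
  have ht₀ := (TwistedIsometryAlgebra.isTwistedIsometries d).isIsometryChain
  obtain ⟨b₀, hb₀⟩ := IsDilationTower.exists_tower hm ht₀
  have hb_tccr : IsTCCR μ fun i : Fin d => b₀ i 0 := by
    have h := hb₀.isCornerTCCR hm ht₀ (Nat.zero_le d)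
    rw [ht₀.zero] at h
    exact h.isTCCR
  obtain ⟨ψ, hψ⟩ := OpRelation.exists_lift (R := tccr d μ) (hR := tccr_isBounded d hμ)
    (fun i : Fin d => b₀ i 0) fun π => hb_tccr.map (OpRelation.toRep _ π)
  -- the isometries in `A_μ` and the homomorphism `φ` that sends the `t_i` to them
  have ha := (TCCRAlgebra.isTCCR d μ hμ).isCornerTCCR
  have ht₁ := ha.isIsometryChain
  have hb₁ := ha.isDilationTower hm
  obtain ⟨φ, hφ⟩ := OpRelation.exists_lift (R := twistedIsometries d)
    (hR := twistedIsometries_isBounded d) (fun i : Fin d => isometricPart μ (IsCornerTCCR.compl μ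
      (extendZero (TCCRAlgebra.a d μ hμ)) i * extendZero (TCCRAlgebra.a d μ hμ) i)) fun π =>
      ht₁.isTwistedIsometries.map (OpRelation.toRep _ π)
  have hφ' : ∀ i < d, φ (extendZero (TwistedIsometryAlgebra.t d) i) =
      isometricPart μ (IsCornerTCCR.compl μ (extendZero (TCCRAlgebra.a d μ hμ)) i *
        extendZero (TCCRAlgebra.a d μ hμ) i) := fun i hi => by
    rw [extendZero_of_lt _ hi]
    exact hφ ⟨i, hi⟩
  have hφb : ∀ i : Fin d, φ (b₀ i 0) = TCCRAlgebra.a d μ hμ i := fun i => by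
    have h := ((hb₀.map φ hm ht₀).congr hφ').unique hm ht₁ hb₁ (Nat.zero_le i) i.2
    rw [h, ht₁.zero, one_mul, extendZero_coe]
  have hψt : ∀ i : Fin d, ψ (φ (TwistedIsometryAlgebra.t d i)) = TwistedIsometryAlgebra.t d i :=
    fun i => by
      have h := (hb₁.map ψ hm ht₁).isometries_unique hm (ht₁.map ψ) ht₀ hb₀ (fun k hk => by
        rw [ht₁.zero, one_mul, extendZero_of_lt _ hk]
        exact hψ ⟨k, hk⟩) i.2
      rwa [extendZero_coe (TwistedIsometryAlgebra.t d), ← hφ i] at h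
  have h₁ : φ.comp ψ = StarAlgHom.id ℂ _ := OpRelation.hom_ext fun i => by
    rw [StarAlgHom.comp_apply, hψ i]
    exact hφb i
  have h₂ : ψ.comp φ = StarAlgHom.id ℂ _ := OpRelation.hom_ext hψt
  refine ⟨StarAlgEquiv.ofStarAlgHom φ ψ h₂ h₁, ?_, fun i j => b₀ i j,
    hb₀.isTildeFamily hm ht₀, hψ⟩
  intro H _ _ _ ρ
  choose U hU using fun i : Fin d => exists_isPolarDecomposition (star (ρ (TCCRAlgebra.a d μ hμ i)))
  refine ⟨fun i => star (U i), _, fun i => by simpa using hU i, fun i => ?_⟩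
  have hb := hb₀.map (ρ.comp φ) hm ht₀
  have h := hb.hatS_eq hm (ht₀.map (ρ.comp φ)) (S := fun i => star (U i))
    (C := fun i => CFC.sqrt (star (star (ρ (TCCRAlgebra.a d μ hμ i))) *
      star (ρ (TCCRAlgebra.a d μ hμ i)))) (fun k => ?_) (fun k => ?_) i
  · rw [h, extendZero_coe]
    rfl
  · rw [StarAlgHom.comp_apply, hφb k, star_star]
    exact hU k
  · rw [StarAlgHom.comp_apply, hφb k]
    simpa using CFC.sqrt_mul_sqrt_self _ (mul_star_self_nonneg (ρ (TCCRAlgebra.a d μ hμ k)))
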